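/- **Setting.** Let $K\ge 1$ drafters and a draft length $N\ge 1$ be given. In each round one drafter is chosen and one step of speculative decoding is performed with it. If drafter $i$ is used in round $t$, let $p_{t,i,j}$ and $q_{t,i,j}$ be the next-token distributions of the target model and of the drafter at the $j$-th drafted position ($1\le j\le N$), and let $\alpha_{i,t,j}=1-d_{TV}(p_{t,i,j},q_{t,i,j})$ be the acceptance rate there. Assume that for each drafter $i$ the rates $\alpha_{i,t,j}$ are i.i.d. from a distribution $\nu_i$ with mean $\alpha_i$, that given its rate a drafted token passes the verification test with probability equal to that rate, independently over positions, and that the rounds are independent. The number $N_{acc}(i,t)$ of accepted tokens is the length of the longest prefix of the draft in which all tokens pass; the round generates $N_{acc}(i,t)+1$ tokens. For a bandit policy $\pi$ (which chooses the drafter $a_t$ from the drafters used and the rates and numbers of accepted tokens observed in earlier rounds), $\tau(\pi,B)$ is the number of rounds until at least $B$ tokens have been generated, and $\pi^\star$ minimizes $\mathbb E[\tau(\pi,B)]$ over all policies. Let $l(t)$ be the number of tokens processed when round $t$ starts (a prompt of $L\ge0$ tokens plus the tokens generated so far). For $\lambda\ge 0$ put $$\mathrm{Reg}_{switch}(\pi,B,\lambda)=\mathbb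 E[\tau(\pi,B)]-\mathbb E[\tau(\pi^\star,B)]+\mathbb E\Big[\sum_{t=2}^{\tau(\pi,B)}\lambda\,\big(l(t)-l(\sigma_t)\big)\,\mathbb 1[a_{t-1}\ne a_t]\Big],$$ where $\sigma_t$ is the latest round before $t$ in which drafter $a_t$ was used, and $l(\sigma_t)$ is replaced by $0$ if there is none. **Rewards.** After a round with drafter $i$ a reward $r_{i,t}$ is computed. It is the block divergence reward $\frac1N\sum_j\alpha_{i,t,j}$, or the block efficiency reward $N_{acc}(i,t)/N$, or any measurable $[0,1]$-valued function of the observed rates and of $N_{acc}(i,t)$ such that every drafter with the highest expected reward also has the highest acceptance rate $\alpha_i$. **Algorithm.** Sequential Halving with budget $B_0$ starts from $S_0=[K]$. In phase $k=0,\dots,\lceil\log_2K\rceil-1$ it uses each drafter of $S_k$ for $n_k=\big\lfloor B_0/(|S_k|\lceil\log_2K\rceil)\big\rfloor$ rounds, one drafter after the other, and lets $S_{k+1}$ consist of the $\lceil|S_k|/2\rceil$ drafters of $S_k$ with the largest total reward in that phase (ties are broken by the index). Pure Exploration-Then-Commit (PETC) with exploration budget $B_0$ runs Sequential Halving with budget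 $B_0$ and then uses the single surviving drafter in all remaining rounds; the process ends as soon as $B$ tokens are generated. **Theorem (regret upper bound on PETC).** For each such environment and reward there is a constant $c>0$ such that PETC with $B_0=c\ln B$ satisfies $\mathrm{Reg}_{switch}(\mathrm{PETC},B,\lambda)=O(\ln B)$ for every $\lambda\ge0$ and every prompt length $L$. That is, for all $\lambda\ge 0$ and $L\ge0$ there is a constant $C$ with $\mathrm{Reg}_{switch}(\mathrm{PETC},B,\lambda)\le C\ln B$ for all integers $B\ge2$. -/

import Mathlib

open MeasureTheory ProbabilityTheory

noncomputable section

namespace MetaSD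

/-! ### Speculative decoding rounds -/

/-- Total variation distance of two distributions on a finite vocabulary. -/
def tvDist {V : Type*} [Fintype V] (p q : PMF V) : ℝ :=
  (1 / 2) * ∑ x, |(p x).toReal - (q x).toReal|

/-- What one speculative decoding round produces at each of the `N` drafted positions: the
acceptance rate at that position, and whether the drafted token passes its verification test. -/
abbrev Draw (N : ℕ) : Type := Fin N → ℝ × Bool

/-- What is observed after a round: the acceptance rates at the `N` positions and the number of
accepted tokens. -/
abbrev Obs (N : ℕ) : Type := (Fin N → ℝ) × ℕ

/-- The number of accepted tokens `N_acc`: the length of the longest prefix of the draft in which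
every token passes its test. -/
def numAccepted {N : ℕ} (d : Draw N) : ℕ :=
  (Finset.univ.filter fun j : Fin N => ∀ k ≤ j, (d k).2 = true).card

/-- The observation that a draw gives. -/
def observe {N : ℕ} (d : Draw N) : Obs N := (fun j => (d j).1, numAccepted d)

/-- The joint law of (acceptance rate, test result) at one position: the rate `a` is drawn from `ν`
and, given `a`, the test is passed with probability `a` (it is passed iff `u ≤ a` for a
uniform `u` in `[0, 1]`). -/
def positionLaw (ν : Measure ℝ) : Measure (ℝ × Bool) :=
  (ν.prod (volume.restrict (Set.Icc (0 : ℝ) 1))).map fun x => (x.1, decide (x.2 ≤ x.1))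

/-- The law of a draw: the `N` positions are independent. -/
def drawLaw (N : ℕ) (ν : Measure ℝ) : Measure (Draw N) :=
  Measure.pi fun _ => positionLaw ν

/-- The stationary environment with `K` drafters and draft length `N`. For round `t`, drafter `i`
and position `j` of its draft, `target t i j` and `draft t i j` are the next-token distributions
of the target model and of the drafter. The acceptance rates `1 - d_TV` of drafter `i` are
i.i.d. with law `ν i`, and rounds are independent. Nothing is assumed about the joint law of
different drafters within one round. -/
structure Env (K N : ℕ) (V : Type*) [Fintype V] {Ω : Type*} [MeasurableSpace Ω]
    (P : Measure Ω) where
  ν : Fin K → Measure ℝ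
  isProb : ∀ i, IsProbabilityMeasure (ν i)
  target : ℕ → Fin K → Fin N → Ω → PMF V
  draft : ℕ → Fin K → Fin N → Ω → PMF V
  passed : ℕ → Fin K → Fin N → Ω → Bool
  measurable_draw : ∀ t i, Measurable fun ω => fun j : Fin N =>
    (1 - tvDist (target t i j ω) (draft t i j ω), passed t i j ω)
  law_draw : ∀ t i, P.map (fun ω => fun j : Fin N =>
    (1 - tvDist (target t i j ω) (draft t i j ω), passed t i j ω)) = drawLaw N (ν i)
  indep_draw : iIndepFun (fun t ω => fun (i : Fin K) (j : Fin N) =>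
    (1 - tvDist (target t i j ω) (draft t i j ω), passed t i j ω)) P

section Env

variable {K N : ℕ} {V : Type*} [Fintype V] {Ω : Type*} [MeasurableSpace Ω] {P : Measure Ω}

/-- What is observed if drafter `i` is used in round `t`. -/
def Env.obs (E : Env K N V P) (ω : Ω) (t : ℕ) (i : Fin K) : Obs N :=
  observe fun j => (1 - tvDist (E.target t i j ω) (E.draft t i j ω), E.passed t i j ω)

/-- The mean acceptance rate `α_i`. -/
def Env.alpha (E : Env K N V P) (i : Fin K) : ℝ := ∫ a, a ∂(E.ν i)

/-- The expected reward `μ_i` of drafter `i` under the reward design `r`. -/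
def Env.meanReward (E : Env K N V P) (r : Obs N → ℝ) (i : Fin K) : ℝ :=
  ∫ d, r (observe d) ∂(drawLaw N (E.ν i))

end Env

/-- Block divergence reward. -/
def bdReward (N : ℕ) (o : Obs N) : ℝ := (1 / (N : ℝ)) * ∑ j, o.1 j

/-- Block efficiency reward. -/
def beReward (N : ℕ) (o : Obs N) : ℝ := (o.2 : ℝ) / N

/-! ### Policies, stopping time, regret -/

/-- The drafters used and the observations made in rounds `0, …, t - 1`. -/
abbrev History (K N t : ℕ) : Type := Fin t → Fin K × Obs N

/-- A bandit policy chooses the drafter of round `t` from the history of the rounds before. -/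
abbrev Policy (K N : ℕ) : Type := (t : ℕ) → History K N t → Fin K

/-- The drafter used in round `t`, where `X s i` is what drafter `i` would give in round `s`. -/
def arm {K N : ℕ} (π : Policy K N) (X : ℕ → Fin K → Obs N) (t : ℕ) : Fin K :=
  π t fun s : Fin t => (arm π X s.1, X s.1 (arm π X s.1))
termination_by t
decreasing_by all_goals exact s.2

/-- The number of tokens generated before round `t`; each round gives `N_acc + 1`. -/
def tokens {K N : ℕ} (π : Policy K N) (X : ℕ → Fin K → Obs N) (t : ℕ) : ℕ :=
  ∑ s ∈ Finset.range t, ((X s (arm π X s)).2 + 1)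

/-- `τ(π, B)`: the number of rounds until `B` tokens are generated. -/
def rounds {K N : ℕ} (π : Policy K N) (X : ℕ → Fin K → Obs N) (B : ℕ) : ℕ :=
  sInf {t | B ≤ tokens π X t}

/-- `l(t)`: the number of tokens processed when round `t` starts, with a prompt of length `L`. -/
def processed {K N : ℕ} (π : Policy K N) (X : ℕ → Fin K → Obs N) (L t : ℕ) : ℕ :=
  L + tokens π X t

/-- The rounds before round `t` that used the drafter of round `t`. -/
def earlierUses {K N : ℕ} (π : Policy K N) (X : ℕ → Fin K → Obs N) (t : ℕ) : Finset ℕ :=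
  (Finset.range t).filter fun s => arm π X s = arm π X t

/-- The switching cost in round `t ≥ 1`: if the drafter changes, `lam` times the number of tokens
processed since the latest round in which the new drafter was used (all tokens processed so
far, if it was never used). -/
def switchCost {K N : ℕ} (π : Policy K N) (X : ℕ → Fin K → Obs N) (lam : ℝ) (L t : ℕ) : ℝ :=
  if arm π X (t - 1) ≠ arm π X t then
    if h : (earlierUses π X t).Nonempty then
      lam * ((processed π X L t : ℝ) - (processed π X L ((earlierUses π X t).max' h) : ℝ))
    else lam * (processed π X L t : ℝ)
  else 0

section Regret

variable {K N : ℕ} {V : Type*} [Fintype V] {Ω : Type*} [MeasurableSpace Ω] {P : Measure Ω}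

/-- `𝔼[τ(π, B)]`. -/
def expectedRounds (E : Env K N V P) (π : Policy K N) (B : ℕ) : ℝ :=
  ∫ ω, (rounds π (E.obs ω) B : ℝ) ∂P

/-- `𝔼[τ(π⋆, B)]`: the least expected number of rounds over all (measurable) policies. -/
def optimalRounds (E : Env K N V P) (B : ℕ) : ℝ :=
  ⨅ π : {π : Policy K N // ∀ t, Measurable (π t)}, expectedRounds E π.1 B

/-- The regret including switching costs. Rounds are numbered from `0`. -/
def regSwitch (E : Env K N V P) (π : Policy K N) (B : ℕ) (lam : ℝ) (L : ℕ) : ℝ :=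
  expectedRounds E π B - optimalRounds E B +
    ∫ ω, ∑ t ∈ Finset.Ico 1 (rounds π (E.obs ω) B), switchCost π (E.obs ω) lam L t ∂P

end Regret

/-! ### Sequential Halving and Pure Exploration-Then-Commit -/

/-- The number of pulls of each surviving drafter in one phase of Sequential Halving with
budget `T`, `⌊T / (|S| ⌈log₂ K⌉)⌋`. -/
def pulls {K : ℕ} (T : ℝ) (S : Finset (Fin K)) : ℕ :=
  ⌊T / ((S.card : ℝ) * (Nat.clog 2 K : ℝ))⌋₊

/-- The `⌈|S| / 2⌉` drafters in `S` with the largest values of `R`; ties are broken in favour of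
the smaller index. -/
def topHalf {K : ℕ} (R : Fin K → ℝ) (S : Finset (Fin K)) : Finset (Fin K) :=
  S.filter fun i =>
    (S.filter fun j => R i < R j ∨ (R j = R i ∧ j < i)).card < (S.card + 1) / 2

/-- The total reward collected from drafter `i` in the rounds `a ≤ s < b`. -/
def phaseReward {K N t : ℕ} (r : Obs N → ℝ) (h : History K N t) (a b : ℕ) (i : Fin K) : ℝ :=
  ∑ s : Fin t, if a ≤ s.1 ∧ s.1 < b ∧ (h s).1 = i then r (h s).2 else 0

/-- Sequential Halving with budget `T`: the surviving drafters after `k` phases, and the first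
round after these phases. -/
def shState {K N t : ℕ} (r : Obs N → ℝ) (T : ℝ) (h : History K N t) :
    ℕ → Finset (Fin K) × ℕ
  | 0 => (Finset.univ, 0)
  | k + 1 =>
    let S := (shState r T h k).1
    let a := (shState r T h k).2
    let b := a + S.card * pulls T S
    (topHalf (phaseReward r h a b) S, b)

/-- The element number `p` (from `0`) of `S` in increasing order. -/
def nthDrafter {K : ℕ} [NeZero K] (S : Finset (Fin K)) (p : ℕ) : Fin K :=
  (S.sort (· ≤ ·)).getD p 0

/-- Pure Exploration-Then-Commit: run the `⌈log₂ K⌉` phases of Sequential Halving with budget `T`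
(in each phase the surviving drafters are used one after the other, `pulls T S` rounds each),
then use the surviving drafter for ever. Here `k` is the number of phases completed
before round `t`. -/
def petc {K N : ℕ} [NeZero K] (r : Obs N → ℝ) (T : ℝ) : Policy K N := fun t h =>
  let k := ((Finset.range (Nat.clog 2 K)).filter fun m => (shState r T h (m + 1)).2 ≤ t).card
  let S := (shState r T h k).1
  let a := (shState r T h k).2
  if k < Nat.clog 2 K then nthDrafter S ((t - a) / pulls T S) else nthDrafter S 0

end MetaSD

end

/-! Let `g i` be the expected number of tokens in a round with drafter `i`. Independence of
positions gives `g i = 1 + α_i + ... + α_i ^ N`, so `g` ranks the drafters as the acceptance rate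
does, and a drafter with the best expected reward also has the largest value `g* = max g`.

The choice of drafter in round `s`, and whether that round is needed, are decided by earlier rounds.
Wald's identity (`Env.integral_tokens_rounds`) therefore says that the expected number of tokens
generated is the expected sum of `g` over the drafters used. Every policy generates at least `B`
tokens and gains at most `g*` per round, so `B / g*` bounds the optimum from below
(`Env.le_optimalRounds`). At most `B + N` tokens are generated, so a policy that uses only best
drafters from round `m` on, outside an event `A`, needs at most `B / g* + N + m + B * P(A)` rounds
in expectation (`Env.expectedRounds_le`).

For PETC, `m` is the length of the exploration, at most the budget `c log B`, and `A` is the event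
that some block of rewards is far from its mean. The phase lengths of Sequential Halving do not
depend on the rewards, and each drafter is explored in a consecutive block at a position from a
deterministic finite list. Hoeffding's inequality and a union bound over all blocks and drafters
thus apply in spite of the adaptive choices, and `P(A) = O(1 / B)` for suitable `c`. Outside `A`
some best drafter survives every phase, because half the reward gap separates the block totals
(`exists_best_mem_survivors`).

Switching costs telescope: the cost of a round is at most the increase of a potential that never
exceeds `K` times the number of tokens processed (`sum_switchCost_le`). After commitment nothing
switches, so only the `O(log B)` tokens of the exploration and the prompt count. -/

namespace MetaSD

section Run

variable {K N : ℕ} (π : Policy K N) {X Y : ℕ → Fin K → Obs N}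

/-! ### Runs of a policy -/

/-- The history of the first `t` rounds. -/
def runHistory (X : ℕ → Fin K → Obs N) (t : ℕ) : History K N t :=
  fun s => (arm π X s, X s (arm π X s))

lemma arm_eq (X : ℕ → Fin K → Obs N) (t : ℕ) : arm π X t = π t (runHistory π X t) := by
  rw [arm]; rfl

/-- Causality: this is what makes the past of a round independent of the round itself. -/
lemma arm_congr {t : ℕ} (h : ∀ s < t, X s = Y s) : arm π X t = arm π Y t := by
  induction t using Nat.strong_induction_on with
  | _ t ih =>
    rw [arm_eq, arm_eq]
    congr 1
    funext s
    have hs := ih s.1 s.2 fun u hu => h u (hu.trans s.2)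
    simp only [runHistory, hs, h s.1 s.2]

lemma tokens_succ (X : ℕ → Fin K → Obs N) (t : ℕ) :
    tokens π X (t + 1) = tokens π X t + ((X t (arm π X t)).2 + 1) :=
  Finset.sum_range_succ _ _

lemma tokens_mono (X : ℕ → Fin K → Obs N) : Monotone (tokens π X) :=
  monotone_nat_of_le_succ fun t => by rw [tokens_succ]; omega

lemma le_tokens (X : ℕ → Fin K → Obs N) (t : ℕ) : t ≤ tokens π X t := by
  induction t with
  | zero => simp
  | succ t ih => rw [tokens_succ]; omega

lemma tokens_le (hX : ∀ t i, (X t i).2 ≤ N) (t : ℕ) : tokens π X t ≤ t * (N + 1) := by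
  induction t with
  | zero => simp [tokens]
  | succ t ih =>
    rw [tokens_succ, add_mul]
    have := hX t (arm π X t)
    omega

lemma tokens_congr {t : ℕ} (h : ∀ s < t, X s = Y s) : tokens π X t = tokens π Y t := by
  refine Finset.sum_congr rfl fun s hs => ?_
  have hs' := Finset.mem_range.1 hs
  rw [arm_congr π fun u hu => h u (hu.trans hs'), h s hs']

lemma le_tokens_rounds (X : ℕ → Fin K → Obs N) (B : ℕ) : B ≤ tokens π X (rounds π X B) :=
  Nat.sInf_mem (s := {t | B ≤ tokens π X t}) ⟨B, le_tokens π X B⟩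

lemma rounds_le (X : ℕ → Fin K → Obs N) (B : ℕ) : rounds π X B ≤ B :=
  Nat.sInf_le (le_tokens π X B)

/-- Whether round `s` is needed is already known when it starts; Wald's identity rests on this. -/
lemma lt_rounds_iff (X : ℕ → Fin K → Obs N) (B s : ℕ) :
    s < rounds π X B ↔ tokens π X s < B := by
  constructor
  · intro h
    exact not_le.1 (Nat.notMem_of_lt_sInf (s := {t | B ≤ tokens π X t}) h)
  · intro h
    by_contra! h'
    have := (le_tokens_rounds π X B).trans (tokens_mono π X h')
    omega

/-- Fewer than `B` tokens exist before the last round, which adds at most `N + 1`. -/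
lemma tokens_rounds_le (hX : ∀ t i, (X t i).2 ≤ N) (B : ℕ) :
    tokens π X (rounds π X B) ≤ B + N := by
  rcases h : rounds π X B with _ | n
  · simp [tokens]
  · have h1 : tokens π X n < B := (lt_rounds_iff π X B n).1 (by omega)
    have := hX n (arm π X n)
    rw [tokens_succ]; omega

/-! ### Switching costs -/

lemma processed_mono (X : ℕ → Fin K → Obs N) (L : ℕ) : Monotone (processed π X L) :=
  fun _ _ h => Nat.add_le_add_left (tokens_mono π X h) L

/-- The number of tokens processed at the latest use of drafter `i` before round `t`
(`0` if there is none). -/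
def lastProcessed (X : ℕ → Fin K → Obs N) (L t : ℕ) (i : Fin K) : ℕ :=
  ((Finset.range t).filter fun s => arm π X s = i).sup (processed π X L)

lemma lastProcessed_le (X : ℕ → Fin K → Obs N) (L t : ℕ) (i : Fin K) :
    lastProcessed π X L t i ≤ processed π X L t :=
  Finset.sup_le fun _ hs =>
    processed_mono π X L (Finset.mem_range.1 (Finset.mem_filter.1 hs).1).le

lemma lastProcessed_succ (X : ℕ → Fin K → Obs N) (L t : ℕ) (i : Fin K) :
    lastProcessed π X L (t + 1) i =
      if arm π X t = i then processed π X L t else lastProcessed π X L t i := by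
  unfold lastProcessed
  rw [Finset.range_add_one, Finset.filter_insert]
  split_ifs with h
  · rw [Finset.sup_insert]
    exact sup_eq_left.2 (lastProcessed_le π X L t i)
  · rfl

/-- Only an inequality, since the right side also charges rounds in which the drafter stays the
same. -/
lemma switchCost_le (X : ℕ → Fin K → Obs N) {lam : ℝ} (hlam : 0 ≤ lam) (L t : ℕ) :
    switchCost π X lam L t ≤
      lam * ((processed π X L t : ℝ) - lastProcessed π X L t (arm π X t)) := by
  have h0 : (0 : ℝ) ≤ (processed π X L t : ℝ) - lastProcessed π X L t (arm π X t) :=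
    sub_nonneg.2 (by exact_mod_cast lastProcessed_le π X L t _)
  unfold switchCost
  split_ifs with h1 h2
  · have : lastProcessed π X L t (arm π X t) =
        processed π X L ((earlierUses π X t).max' h2) :=
      le_antisymm
        (Finset.sup_le fun s hs => processed_mono π X L (Finset.le_max' _ s hs))
        (Finset.le_sup (f := processed π X L) (Finset.max'_mem _ h2))
    rw [this]
  · have : lastProcessed π X L t (arm π X t) = 0 := by
      have h3 : earlierUses π X t = ∅ := Finset.not_nonempty_iff_eq_empty.1 h2
      unfold lastProcessed
      unfold earlierUses at h3
      rw [h3]; rfl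
    rw [this]; simp
  · positivity

lemma switchCost_nonneg (X : ℕ → Fin K → Obs N) {lam : ℝ} (hlam : 0 ≤ lam) (L t : ℕ) :
    0 ≤ switchCost π X lam L t := by
  unfold switchCost
  split_ifs with h1 h2
  · refine mul_nonneg hlam (sub_nonneg.2 ?_)
    have := Finset.max'_mem _ h2
    exact_mod_cast processed_mono π X L
      (Finset.mem_range.1 (Finset.mem_filter.1 this).1).le
  · positivity
  · exact le_rfl

/-- Round `t` moves only the marker of its own drafter, up to the current token count. The sum of
the markers is the potential against which switching costs telescope. -/
lemma sum_lastProcessed_succ (X : ℕ → Fin K → Obs N) (L t : ℕ) :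
    (∑ i, (lastProcessed π X L (t + 1) i : ℝ)) = (∑ i, (lastProcessed π X L t i : ℝ)) +
      ((processed π X L t : ℝ) - lastProcessed π X L t (arm π X t)) := by
  rw [← Finset.add_sum_erase _ _ (Finset.mem_univ (arm π X t)),
    ← Finset.add_sum_erase (a := arm π X t) _ (fun i => (lastProcessed π X L t i : ℝ))
      (Finset.mem_univ _), lastProcessed_succ, if_pos rfl]
  have : ∑ i ∈ Finset.univ.erase (arm π X t), (lastProcessed π X L (t + 1) i : ℝ) =
      ∑ i ∈ Finset.univ.erase (arm π X t), (lastProcessed π X L t i : ℝ) :=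
    Finset.sum_congr rfl fun i hi => by
      rw [lastProcessed_succ, if_neg (Finset.ne_of_mem_erase hi).symm]
  rw [this]; ring

lemma sum_switchCost_le (X : ℕ → Fin K → Obs N) {lam : ℝ} (hlam : 0 ≤ lam) (L m : ℕ) :
    ∑ t ∈ Finset.range m, switchCost π X lam L t ≤ lam * (K * processed π X L m) := by
  have h : ∑ t ∈ Finset.range m, switchCost π X lam L t ≤
      lam * ∑ i, (lastProcessed π X L m i : ℝ) := by
    induction m with
    | zero => simp [lastProcessed]
    | succ m ih =>
      rw [Finset.sum_range_succ, sum_lastProcessed_succ, mul_add]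
      exact add_le_add ih (switchCost_le π X hlam L m)
  refine h.trans (mul_le_mul_of_nonneg_left ?_ hlam)
  calc ∑ i, (lastProcessed π X L m i : ℝ) ≤ ∑ _i : Fin K, (processed π X L m : ℝ) :=
        Finset.sum_le_sum fun i _ => by exact_mod_cast lastProcessed_le π X L m i
    _ = _ := by simp

/-- If the drafter no longer changes after round `m`, only the first `m` rounds cause switching
costs. -/
lemma sum_switchCost_le_of_const (hX : ∀ t i, (X t i).2 ≤ N) {lam : ℝ} (hlam : 0 ≤ lam)
    (L m n : ℕ) (hm : ∀ t, m ≤ t → arm π X t = arm π X m) :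
    ∑ t ∈ Finset.Ico 1 n, switchCost π X lam L t ≤
      lam * (K * (L + (m + 1) * (N + 1))) := by
  -- A round after `m` has the same drafter as its predecessor and costs nothing; round `m` itself
  -- may still switch, hence `m + 1`.
  have h1 : ∑ t ∈ Finset.Ico 1 n, switchCost π X lam L t ≤
      ∑ t ∈ Finset.range (m + 1), switchCost π X lam L t := by
    have h2 : ∑ t ∈ Finset.Ico 1 n, switchCost π X lam L t =
        ∑ t ∈ (Finset.Ico 1 n).filter (· < m + 1), switchCost π X lam L t := by
      symm
      refine Finset.sum_filter_of_ne fun t _ h => ?_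
      by_contra! h'
      refine h (if_neg (not_not.2 ?_))
      rw [hm t (by omega), hm (t - 1) (by omega)]
    rw [h2]
    refine Finset.sum_le_sum_of_subset_of_nonneg (fun t ht => ?_)
      fun t _ _ => switchCost_nonneg π X hlam L t
    exact Finset.mem_range.2 (Finset.mem_filter.1 ht).2
  refine h1.trans ((sum_switchCost_le π X hlam L (m + 1)).trans ?_)
  have := tokens_le π hX (m + 1)
  have h3 : (processed π X L (m + 1) : ℝ) ≤ L + (m + 1) * (N + 1) := by
    unfold processed
    exact_mod_cast Nat.add_le_add_left this L
  gcongr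

end Run

/-! ### The law of a round -/

lemma tvDist_mem_Icc {V : Type*} [Fintype V] (p q : PMF V) : tvDist p q ∈ Set.Icc (0 : ℝ) 1 := by
  have hsum : ∀ p : PMF V, ∑ x, (p x).toReal = 1 := fun p => by
    rw [← ENNReal.toReal_sum fun x _ => p.apply_ne_top x, ← tsum_fintype (L := .unconditional _),
      p.tsum_coe, ENNReal.toReal_one]
  unfold tvDist
  have h0 : 0 ≤ ∑ x, |(p x).toReal - (q x).toReal| := Finset.sum_nonneg fun _ _ => abs_nonneg _
  have h1 : ∑ x, |(p x).toReal - (q x).toReal| ≤ ∑ x, ((p x).toReal + (q x).toReal) :=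
    Finset.sum_le_sum fun x _ => by
      rw [abs_le]
      have := (p x).toReal_nonneg
      have := (q x).toReal_nonneg
      constructor <;> linarith
  rw [Finset.sum_add_distrib, hsum, hsum] at h1
  constructor <;> linarith

section Law

variable {N : ℕ}

lemma numAccepted_le (d : Draw N) : numAccepted d ≤ N :=
  (Finset.card_filter_le _ _).trans (by simp)

lemma measurable_numAccepted : Measurable (numAccepted : Draw N → ℕ) := by
  have h : (numAccepted : Draw N → ℕ) = (fun b : Fin N → Bool =>
      (Finset.univ.filter fun j : Fin N => ∀ k ≤ j, b k = true).card) ∘ fun d k => (d k).2 := rfl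
  rw [h]
  exact (measurable_of_countable _).comp (by fun_prop)

lemma measurable_observe : Measurable (observe : Draw N → Obs N) := by
  unfold observe
  exact Measurable.prodMk (by fun_prop) measurable_numAccepted

lemma measurable_test : Measurable fun x : ℝ × ℝ => (x.1, decide (x.2 ≤ x.1)) := by
  refine Measurable.prodMk measurable_fst (measurable_to_bool ?_)
  have : (fun x : ℝ × ℝ => decide (x.2 ≤ x.1)) ⁻¹' {true} = {x | x.2 ≤ x.1} := by
    ext; simp
  rw [this]
  exact measurableSet_le measurable_snd measurable_fst

instance isProbabilityMeasure_restrict_Icc :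
    IsProbabilityMeasure (volume.restrict (Set.Icc (0 : ℝ) 1)) :=
  ⟨by simp⟩

variable (ν : Measure ℝ)

lemma map_fst_positionLaw : (positionLaw ν).map Prod.fst = ν := by
  unfold positionLaw
  rw [Measure.map_map measurable_fst measurable_test]
  have : (Prod.fst ∘ fun x : ℝ × ℝ => (x.1, decide (x.2 ≤ x.1))) = Prod.fst := rfl
  rw [this, Measure.map_fst_prod]; simp

variable [IsProbabilityMeasure ν]

instance isProbabilityMeasure_positionLaw : IsProbabilityMeasure (positionLaw ν) :=
  Measure.isProbabilityMeasure_map measurable_test.aemeasurable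

instance isProbabilityMeasure_drawLaw : IsProbabilityMeasure (drawLaw N ν) := by
  unfold drawLaw; infer_instance

lemma integral_rate (j : Fin N) : ∫ d, (d j).1 ∂(drawLaw N ν) = ∫ a, a ∂ν := by
  unfold drawLaw
  rw [integral_comp_eval (μ := fun _ : Fin N => positionLaw ν) (i := j)
    (f := fun x : ℝ × Bool => x.1) measurable_fst.aestronglyMeasurable]
  conv_rhs => rw [← map_fst_positionLaw ν]
  exact (integral_map measurable_fst.aemeasurable
    (f := fun a : ℝ => a) measurable_id.aestronglyMeasurable).symm

lemma integrable_rate (hν : ∀ᵐ a ∂ν, a ∈ Set.Icc (0 : ℝ) 1) : Integrable (fun a : ℝ => a) ν :=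
  Integrable.of_mem_Icc 0 1 measurable_id.aemeasurable hν

/-- Fubini: given a rate `a` in `[0, 1]`, the uniform variable is at most `a` with probability `a`.
-/
lemma positionLaw_pass (hν : ∀ᵐ a ∂ν, a ∈ Set.Icc (0 : ℝ) 1) :
    positionLaw ν {x | x.2 = true} = ENNReal.ofReal (∫ a, a ∂ν) := by
  have hm : MeasurableSet {x : ℝ × Bool | x.2 = true} :=
    measurable_snd (measurableSet_singleton true)
  unfold positionLaw
  rw [Measure.map_apply measurable_test hm]
  have hset : MeasurableSet {x : ℝ × ℝ | x.2 ≤ x.1} :=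
    measurableSet_le measurable_snd measurable_fst
  have : (fun x : ℝ × ℝ => (x.1, decide (x.2 ≤ x.1))) ⁻¹' {x | x.2 = true} =
      {x | x.2 ≤ x.1} := by ext; simp
  rw [this, Measure.prod_apply hset,
    ofReal_integral_eq_lintegral_ofReal (integrable_rate ν hν) (hν.mono fun a ha => ha.1)]
  refine lintegral_congr_ae (hν.mono fun a ha => ?_)
  have h2 : Prod.mk a ⁻¹' {x : ℝ × ℝ | x.2 ≤ x.1} = Set.Iic a := by ext; simp
  simp only [h2]
  rw [Measure.restrict_apply measurableSet_Iic]
  have h3 : Set.Iic a ∩ Set.Icc (0 : ℝ) 1 = Set.Icc 0 a := by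
    ext u
    simp only [Set.mem_inter_iff, Set.mem_Iic, Set.mem_Icc]
    have := ha.2
    constructor
    · rintro ⟨h, h', -⟩; exact ⟨h', h⟩
    · rintro ⟨h, h'⟩; exact ⟨h', h, h'.trans this⟩
  rw [h3]; simp

lemma drawLaw_prefix (hν : ∀ᵐ a ∂ν, a ∈ Set.Icc (0 : ℝ) 1) (j : Fin N) :
    (drawLaw N ν).real {d | ∀ k ≤ j, (d k).2 = true} = (∫ a, a ∂ν) ^ (j.1 + 1) := by
  have h0 : 0 ≤ ∫ a, a ∂ν := integral_nonneg_of_ae (hν.mono fun a ha => ha.1)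
  have h1 : {d : Draw N | ∀ k ≤ j, (d k).2 = true} = Set.pi Set.univ fun k =>
      if k ≤ j then {x : ℝ × Bool | x.2 = true} else Set.univ := by
    ext d
    simp only [Set.mem_ofPred_eq, Set.mem_pi, Set.mem_univ, true_implies]
    refine forall_congr' fun k => ?_
    split_ifs with h <;> simp [h]
  unfold drawLaw
  rw [measureReal_def, h1, Measure.pi_pi]
  have h2 : ∀ k : Fin N, positionLaw ν (if k ≤ j then {x : ℝ × Bool | x.2 = true} else Set.univ) =
      if k ≤ j then ENNReal.ofReal (∫ a, a ∂ν) else 1 := fun k => by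
    split_ifs with h
    · exact positionLaw_pass ν hν
    · exact measure_univ
  simp only [h2]
  rw [Finset.prod_ite, Finset.prod_const_one, mul_one, Finset.prod_const, ENNReal.toReal_pow,
    ENNReal.toReal_ofReal h0]
  congr 1
  have : (Finset.univ.filter fun k : Fin N => k ≤ j) = Finset.Iic j := by ext; simp
  rw [this, Fin.card_Iic]

lemma integrable_numAccepted : Integrable (fun d => (numAccepted d : ℝ)) (drawLaw N ν) := by
  refine Integrable.of_mem_Icc 0 N ?_ (.of_forall fun d => ⟨by positivity, ?_⟩)
  · exact (measurable_from_nat.comp measurable_numAccepted).aemeasurable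
  · exact_mod_cast numAccepted_le d

/-- The accepted length counts the positions whose whole prefix passes, so it is a sum of
indicators. Its mean depends on `ν` only through the mean rate. -/
lemma integral_numAccepted (hν : ∀ᵐ a ∂ν, a ∈ Set.Icc (0 : ℝ) 1) :
    ∫ d, (numAccepted d : ℝ) ∂(drawLaw N ν) = ∑ j : Fin N, (∫ a, a ∂ν) ^ (j.1 + 1) := by
  have hm : ∀ j : Fin N, MeasurableSet {d : Draw N | ∀ k ≤ j, (d k).2 = true} := fun j => by
    simp only [Set.ofPred_forall]
    refine MeasurableSet.iInter fun k => MeasurableSet.iInter fun _ => ?_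
    exact (measurable_snd.comp (measurable_pi_apply k)) (measurableSet_singleton true)
  have h : ∀ d : Draw N, (numAccepted d : ℝ) =
      ∑ j : Fin N, ({d : Draw N | ∀ k ≤ j, (d k).2 = true}.indicator (fun _ => (1 : ℝ)) d) := fun d => by
    unfold numAccepted
    rw [Finset.card_filter]
    push_cast
    refine Finset.sum_congr rfl fun j _ => ?_
    simp [Set.indicator_apply]
  simp only [h]
  rw [integral_finsetSum _ fun j _ => (integrable_const (1 : ℝ)).indicator (hm j)]
  refine Finset.sum_congr rfl fun j _ => ?_
  rw [integral_indicator_const _ (hm j), drawLaw_prefix ν hν, smul_eq_mul, mul_one]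

end Law

/-! ### Rounds of an environment -/

section Env

variable {K N : ℕ} {V : Type*} [Fintype V] {Ω : Type*} [MeasurableSpace Ω] {P : Measure Ω}
  (E : Env K N V P)

instance (i : Fin K) : IsProbabilityMeasure (E.ν i) := E.isProb i

lemma Env.rate_mem_Icc (ω : Ω) (t : ℕ) (i : Fin K) (j : Fin N) :
    (E.obs ω t i).1 j ∈ Set.Icc (0 : ℝ) 1 := by
  have := tvDist_mem_Icc (E.target t i j ω) (E.draft t i j ω)
  change 1 - tvDist (E.target t i j ω) (E.draft t i j ω) ∈ _
  constructor <;> linarith [this.1, this.2]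

lemma Env.obs_snd_le (ω : Ω) (t : ℕ) (i : Fin K) : (E.obs ω t i).2 ≤ N := numAccepted_le _

lemma Env.measurable_obs (t : ℕ) : Measurable fun ω => E.obs ω t :=
  measurable_pi_lambda _ fun i => measurable_observe.comp (E.measurable_draw t i)

lemma Env.measurable_obs_apply (t : ℕ) (i : Fin K) : Measurable fun ω => E.obs ω t i :=
  measurable_observe.comp (E.measurable_draw t i)

lemma Env.indep_obs : iIndepFun (fun t ω => E.obs ω t) P :=
  E.indep_draw.comp (fun _ x i => observe (x i))
    fun _ => measurable_pi_lambda _ fun i => measurable_observe.comp (measurable_pi_apply i)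

lemma Env.integral_obs (t : ℕ) (i : Fin K) {f : Obs N → ℝ} (hf : Measurable f) :
    ∫ ω, f (E.obs ω t i) ∂P = ∫ d, f (observe d) ∂(drawLaw N (E.ν i)) := by
  rw [← E.law_draw t i]
  exact (integral_map (E.measurable_draw t i).aemeasurable
    (hf.comp measurable_observe).aestronglyMeasurable).symm

/-- The support of `ν i` is not an assumption: the rates are `1 - tvDist`, and `ν i` is their law at
position `0`, which exists because `N` is positive. -/
lemma Env.ae_rate_mem_Icc (hN : 0 < N) (i : Fin K) : ∀ᵐ a ∂(E.ν i), a ∈ Set.Icc (0 : ℝ) 1 := by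
  have hd : ∀ᵐ d ∂(drawLaw N (E.ν i)), (d ⟨0, hN⟩).1 ∈ Set.Icc (0 : ℝ) 1 := by
    rw [← E.law_draw 0 i]
    refine (ae_map_iff (E.measurable_draw 0 i).aemeasurable ?_).2
      (.of_forall fun ω => E.rate_mem_Icc ω 0 i ⟨0, hN⟩)
    exact (measurable_fst.comp (measurable_pi_apply _)) measurableSet_Icc
  have hp : ∀ᵐ x ∂(positionLaw (E.ν i)), x.1 ∈ Set.Icc (0 : ℝ) 1 := by
    rw [← (measurePreserving_eval (fun _ : Fin N => positionLaw (E.ν i)) ⟨0, hN⟩).map_eq]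
    exact (ae_map_iff (f := fun d : Draw N => d ⟨0, hN⟩)
      (measurable_pi_apply (⟨0, hN⟩ : Fin N)).aemeasurable (measurable_fst measurableSet_Icc)).2 hd
  rw [← map_fst_positionLaw (E.ν i)]
  exact (ae_map_iff measurable_fst.aemeasurable measurableSet_Icc).2 hp

lemma Env.alpha_mem_Icc (hN : 0 < N) (i : Fin K) : E.alpha i ∈ Set.Icc (0 : ℝ) 1 := by
  have h := E.ae_rate_mem_Icc hN i
  refine ⟨integral_nonneg_of_ae (h.mono fun a ha => ha.1), ?_⟩
  have := integral_mono_ae (integrable_rate _ h) (integrable_const (1 : ℝ))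
    (h.mono fun a ha => ha.2)
  simpa [Env.alpha] using this

/-- The expected number of tokens generated in a round with drafter `i`. -/
noncomputable def Env.meanTokens (i : Fin K) : ℝ :=
  ∫ d, ((numAccepted d : ℝ) + 1) ∂(drawLaw N (E.ν i))

lemma Env.meanTokens_eq (hN : 0 < N) (i : Fin K) :
    E.meanTokens i = (∑ j : Fin N, E.alpha i ^ (j.1 + 1)) + 1 := by
  unfold Env.meanTokens
  rw [integral_add (integrable_numAccepted _) (integrable_const _),
    integral_numAccepted _ (E.ae_rate_mem_Icc hN i)]
  simp [Env.alpha]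

lemma Env.one_le_meanTokens (hN : 0 < N) (i : Fin K) : 1 ≤ E.meanTokens i := by
  rw [E.meanTokens_eq hN]
  have : 0 ≤ ∑ j : Fin N, E.alpha i ^ (j.1 + 1) :=
    Finset.sum_nonneg fun j _ => pow_nonneg (E.alpha_mem_Icc hN i).1 _
  linarith

lemma Env.meanTokens_mono (hN : 0 < N) {i j : Fin K} (h : E.alpha i ≤ E.alpha j) :
    E.meanTokens i ≤ E.meanTokens j := by
  rw [E.meanTokens_eq hN, E.meanTokens_eq hN]
  have h0 := (E.alpha_mem_Icc hN i).1
  gcongr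

/-- For `N > 0` the polynomial `1 + α + ... + α ^ N` is strictly increasing on nonnegative `α`. -/
lemma Env.alpha_le_of_meanTokens_le (hN : 0 < N) {i j : Fin K}
    (h : E.meanTokens i ≤ E.meanTokens j) : E.alpha i ≤ E.alpha j := by
  by_contra! hlt
  refine absurd h (not_le.2 ?_)
  rw [E.meanTokens_eq hN, E.meanTokens_eq hN]
  have h0 := (E.alpha_mem_Icc hN j).1
  have : Nonempty (Fin N) := ⟨⟨0, hN⟩⟩
  have := Finset.sum_lt_sum_of_nonempty (s := (Finset.univ : Finset (Fin N)))
    (f := fun l => E.alpha j ^ (l.1 + 1)) (g := fun l => E.alpha i ^ (l.1 + 1))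
    Finset.univ_nonempty fun l _ => pow_lt_pow_left₀ hlt h0 (Nat.succ_ne_zero _)
  linarith

/-! ### Rewards -/

lemma meanReward_bdReward (hN : 0 < N) (i : Fin K) :
    E.meanReward (bdReward N) i = E.alpha i := by
  unfold Env.meanReward bdReward
  have hint : ∀ j : Fin N, Integrable (fun d : Draw N => (d j).1) (drawLaw N (E.ν i)) := fun j => by
    have h := integrable_rate _ (E.ae_rate_mem_Icc hN i)
    rw [← map_fst_positionLaw (E.ν i)] at h
    exact (measurePreserving_eval (fun _ : Fin N => positionLaw (E.ν i)) j).integrable_comp_of_integrable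
      (h.comp_measurable measurable_fst)
  change ∫ d : Draw N, 1 / (N : ℝ) * ∑ j, (d j).1 ∂_ = _
  rw [integral_const_mul, integral_finsetSum _ fun j _ => hint j]
  simp only [integral_rate]
  have : (N : ℝ) ≠ 0 := by positivity
  simp [Env.alpha, this]

lemma meanReward_beReward (i : Fin K) :
    E.meanReward (beReward N) i = (E.meanTokens i - 1) / N := by
  unfold Env.meanReward beReward Env.meanTokens
  rw [integral_add (integrable_numAccepted _) (integrable_const _)]
  change ∫ d : Draw N, (numAccepted d : ℝ) / N ∂_ = _
  rw [integral_div]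
  simp

/-- The reward designs of the theorem: measurable, `[0, 1]`-valued on the possible observations,
and a drafter with the highest expected reward has the highest acceptance rate. -/
def Env.IsRewardDesign (r : Obs N → ℝ) : Prop :=
  Measurable r ∧
    (∀ (a : Fin N → ℝ) (n : ℕ), (∀ j, a j ∈ Set.Icc (0 : ℝ) 1) → n ≤ N →
      r (a, n) ∈ Set.Icc (0 : ℝ) 1) ∧
    ∀ i, (∀ j, E.meanReward r j ≤ E.meanReward r i) → ∀ j, E.alpha j ≤ E.alpha i

lemma Env.isRewardDesign_bdReward (hN : 0 < N) : E.IsRewardDesign (bdReward N) := by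
  refine ⟨by unfold bdReward; fun_prop, fun a n ha _ => ⟨?_, ?_⟩, fun i h j => ?_⟩
  · exact mul_nonneg (by positivity) (Finset.sum_nonneg fun j _ => (ha j).1)
  · have h : ∑ j, a j ≤ ∑ _j : Fin N, (1 : ℝ) := Finset.sum_le_sum fun j _ => (ha j).2
    simp only [Finset.sum_const, Finset.card_univ, Fintype.card_fin, nsmul_eq_mul, mul_one] at h
    unfold bdReward
    rw [one_div, inv_mul_le_iff₀ (by positivity)]
    simpa using h
  · simpa only [meanReward_bdReward E hN] using h j

lemma Env.isRewardDesign_beReward (hN : 0 < N) : E.IsRewardDesign (beReward N) := by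
  refine ⟨?_, fun a n _ hn => ⟨?_, ?_⟩, fun i h j => ?_⟩
  · unfold beReward
    exact (measurable_from_nat.comp measurable_snd).div_const _
  · unfold beReward; positivity
  · unfold beReward
    rw [div_le_one (by positivity)]
    exact_mod_cast hn
  · have := h j
    rw [meanReward_beReward, meanReward_beReward,
      div_le_div_iff_of_pos_right (by positivity)] at this
    exact E.alpha_le_of_meanTokens_le hN (by linarith)

end Env

/-! ### Wald's identity -/

section Wald

variable {K N : ℕ} {π : Policy K N}

lemma measurable_apply_countable {α β ι : Type*} [MeasurableSpace α] [MeasurableSpace β]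
    [MeasurableSpace ι] [Countable ι] [MeasurableSingletonClass ι] {a : α → ι} {f : α → ι → β}
    (ha : Measurable a) (hf : ∀ i, Measurable fun x => f x i) : Measurable fun x => f x (a x) := by
  have h : Measurable fun p : α × ι => f p.1 p.2 := measurable_from_prod_countable_left hf
  exact h.comp (measurable_id.prodMk ha)

lemma measurable_arm (hπ : ∀ t, Measurable (π t)) (t : ℕ) :
    Measurable fun X : ℕ → Fin K → Obs N => arm π X t := by
  induction t using Nat.strong_induction_on with
  | _ t ih =>
    simp only [arm_eq]
    refine (hπ t).comp (measurable_pi_lambda _ fun s => ?_)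
    exact (ih s.1 s.2).prodMk (measurable_apply_countable (ih s.1 s.2)
      fun i => by fun_prop)

lemma measurable_tokens (hπ : ∀ t, Measurable (π t)) (t : ℕ) :
    Measurable fun X : ℕ → Fin K → Obs N => tokens π X t := by
  refine Finset.measurable_fun_sum _ fun s _ => Measurable.add_const ?_ 1
  exact measurable_apply_countable (f := fun (X : ℕ → Fin K → Obs N) i => (X s i).2)
    (measurable_arm hπ s) fun i => by fun_prop

lemma measurable_rounds (hπ : ∀ t, Measurable (π t)) (B : ℕ) :
    Measurable fun X : ℕ → Fin K → Obs N => rounds π X B := by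
  refine measurable_of_Iio fun n => ?_
  -- The case `n = 0` is excluded separately because `n - 1` is truncated.
  have : (fun X : ℕ → Fin K → Obs N => rounds π X B) ⁻¹' Set.Iio n =
      {X | n = 0} ᶜ ∩ {X | B ≤ tokens π X (n - 1)} := by
    ext X
    simp only [Set.mem_preimage, Set.mem_Iio, Set.mem_inter_iff, Set.mem_compl_iff,
      Set.mem_ofPred_eq]
    have := lt_rounds_iff π X B (n - 1)
    omega
  rw [this]
  exact (MeasurableSet.const _).compl.inter
    (measurableSet_le measurable_const (measurable_tokens hπ _))

variable {V : Type*} [Fintype V] {Ω : Type*} [MeasurableSpace Ω] {P : Measure Ω}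
  (E : Env K N V P)

lemma Env.measurable_obs_all : Measurable fun ω => E.obs ω :=
  measurable_pi_lambda _ fun t => E.measurable_obs t

/-- What happens before round `s` is independent of what happens in round `s`. -/
lemma Env.indepFun_past (hπ : ∀ t, Measurable (π t)) (s : ℕ) :
    IndepFun (fun ω => (arm π (E.obs ω) s, tokens π (E.obs ω) s)) (fun ω => E.obs ω s) P := by
  have h := E.indep_obs.indepFun_finset (Finset.range s) {s} (by simp) E.measurable_obs
  -- Padding the first `s` rounds with a dummy value presents the past as a function of those rounds
  -- alone; by `arm_congr` and `tokens_congr` the padding is irrelevant.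
  let ext : ((t : Finset.range s) → Fin K → Obs N) → ℕ → Fin K → Obs N :=
    fun x t => if ht : t ∈ Finset.range s then x ⟨t, ht⟩ else 0
  have hext : Measurable ext := by
    refine measurable_pi_lambda _ fun t => ?_
    by_cases ht : t ∈ Finset.range s
    · simp only [ext, dif_pos ht]; exact measurable_pi_apply _
    · simp only [ext, dif_neg ht]; exact measurable_const
  have hlast : Measurable fun x : (({s} : Finset ℕ) → Fin K → Obs N) =>
      x ⟨s, Finset.mem_singleton_self s⟩ := measurable_pi_apply _
  have h2 := h.comp (φ := fun x => (arm π (ext x) s, tokens π (ext x) s))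
    (ψ := fun x => x ⟨s, Finset.mem_singleton_self s⟩)
    (((measurable_arm hπ s).comp hext).prodMk ((measurable_tokens hπ s).comp hext))
    hlast
  have hcongr : ∀ ω, ∀ u < s, ext (fun t : Finset.range s => E.obs ω t) u = E.obs ω u :=
    fun ω u hu => dif_pos (Finset.mem_range.2 hu)
  have h3 : ((fun x => (arm π (ext x) s, tokens π (ext x) s)) ∘
      fun ω (t : Finset.range s) => E.obs ω t) =
      fun ω => (arm π (E.obs ω) s, tokens π (E.obs ω) s) := by
    funext ω
    simp only [Function.comp_apply, arm_congr π (hcongr ω), tokens_congr π (hcongr ω)]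
  rw [h3] at h2
  exact h2

lemma Env.integral_obs_snd (s : ℕ) (i : Fin K) :
    ∫ ω, (((E.obs ω s i).2 : ℝ) + 1) ∂P = E.meanTokens i :=
  E.integral_obs s i (f := fun o => (o.2 : ℝ) + 1)
    ((measurable_from_nat.comp measurable_snd).add_const _)

/-- The event that drafter `i` is used in round `s` and that this round is needed. -/
def Env.useSet (π : Policy K N) (B s : ℕ) (i : Fin K) : Set Ω :=
  {ω | arm π (E.obs ω) s = i ∧ s < rounds π (E.obs ω) B}

lemma Env.measurableSet_useSet (hπ : ∀ t, Measurable (π t)) (B s : ℕ) (i : Fin K) :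
    MeasurableSet (E.useSet π B s i) := by
  have h1 := ((measurable_arm hπ s).comp E.measurable_obs_all) (measurableSet_singleton i)
  have h2 := ((measurable_rounds hπ B).comp E.measurable_obs_all) (measurableSet_Ioi (a := s))
  exact h1.inter h2

/-- Since at most `B` rounds are needed, a sum of random length becomes a fixed finite sum of
indicators, which can be integrated term by term. -/
lemma Env.sum_rounds_eq (π : Policy K N) (B : ℕ) (f : ℕ → Fin K → Ω → ℝ) (ω : Ω) :
    ∑ s ∈ Finset.range (rounds π (E.obs ω) B), f s (arm π (E.obs ω) s) ω =
      ∑ s ∈ Finset.range B, ∑ i, (E.useSet π B s i).indicator (f s i) ω := by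
  have h : Finset.range (rounds π (E.obs ω) B) =
      (Finset.range B).filter (· < rounds π (E.obs ω) B) := by
    ext s
    have := rounds_le π (E.obs ω) B
    simp only [Finset.mem_range, Finset.mem_filter]
    omega
  rw [h, Finset.sum_filter]
  refine Finset.sum_congr rfl fun s _ => ?_
  split_ifs with hs
  · rw [Finset.sum_eq_single (arm π (E.obs ω) s)]
    · rw [Set.indicator_of_mem]; exact ⟨rfl, hs⟩
    · intro i _ hi
      exact Set.indicator_of_notMem (fun hω => hi hω.1.symm) _
    · simp
  · exact (Finset.sum_eq_zero fun i _ => Set.indicator_of_notMem (fun hω => hs hω.2) _).symm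

variable [IsProbabilityMeasure P]

lemma Env.integrable_obs_snd (s : ℕ) (i : Fin K) :
    Integrable (fun ω => ((E.obs ω s i).2 : ℝ) + 1) P := by
  refine Integrable.of_mem_Icc 0 (N + 1) ?_ (.of_forall fun ω => ⟨by positivity, ?_⟩)
  · exact ((measurable_from_nat.comp
      (measurable_snd.comp (E.measurable_obs_apply s i))).add_const _).aemeasurable
  · have := E.obs_snd_le ω s i
    have : ((E.obs ω s i).2 : ℝ) ≤ N := by exact_mod_cast this
    linarith

/-- The event is determined by the past of round `s`, so it is independent of the tokens of that
round and the expectation factorizes. -/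
lemma Env.integral_useSet (hπ : ∀ t, Measurable (π t)) (B s : ℕ) (i : Fin K) :
    ∫ ω, (E.useSet π B s i).indicator (fun ω => ((E.obs ω s i).2 : ℝ) + 1) ω ∂P =
      ∫ ω, (E.useSet π B s i).indicator (fun _ => E.meanTokens i) ω ∂P := by
  have h := (E.indepFun_past hπ s).comp
    (φ := fun p : Fin K × ℕ => (if p.1 = i ∧ p.2 < B then 1 else 0 : ℝ))
    (ψ := fun x : Fin K → Obs N => ((x i).2 : ℝ) + 1)
    (measurable_of_countable _)
    ((measurable_from_nat.comp (measurable_snd.comp (measurable_pi_apply i))).add_const _)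
  have hind : ∀ ω, ((fun p : Fin K × ℕ => (if p.1 = i ∧ p.2 < B then 1 else 0 : ℝ)) ∘
      fun ω => (arm π (E.obs ω) s, tokens π (E.obs ω) s)) ω =
      (E.useSet π B s i).indicator (fun _ => (1 : ℝ)) ω := fun ω => by
    simp only [Function.comp_apply, Env.useSet, Set.indicator_apply, Set.mem_ofPred_eq,
      lt_rounds_iff]
  have hmul := h.integral_fun_mul_eq_mul_integral
    ?_ (E.integrable_obs_snd s i).aestronglyMeasurable
  · simp only [hind] at hmul
    have e1 : ∀ ω, (E.useSet π B s i).indicator (fun ω => ((E.obs ω s i).2 : ℝ) + 1) ω =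
        (E.useSet π B s i).indicator (fun _ => (1 : ℝ)) ω *
          ((fun x : Fin K → Obs N => ((x i).2 : ℝ) + 1) ∘ fun ω => E.obs ω s) ω := fun ω => by
      by_cases hω : ω ∈ E.useSet π B s i <;> simp [hω]
    have e2 : ∀ ω, (E.useSet π B s i).indicator (fun _ => E.meanTokens i) ω =
        (E.useSet π B s i).indicator (fun _ => (1 : ℝ)) ω * E.meanTokens i := fun ω => by
      by_cases hω : ω ∈ E.useSet π B s i <;> simp [hω]
    simp only [e1, e2]
    rw [hmul, integral_mul_const]
    congr 1
    exact E.integral_obs_snd s i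
  · have : Measurable ((fun p : Fin K × ℕ => (if p.1 = i ∧ p.2 < B then 1 else 0 : ℝ)) ∘
      fun ω => (arm π (E.obs ω) s, tokens π (E.obs ω) s)) :=
      (measurable_of_countable _).comp
        (((measurable_arm hπ s).comp E.measurable_obs_all).prodMk
          ((measurable_tokens hπ s).comp E.measurable_obs_all))
    exact this.aestronglyMeasurable

/-- Wald's identity for a policy that mixes drafters. -/
lemma Env.integral_tokens_rounds (hπ : ∀ t, Measurable (π t)) (B : ℕ) :
    ∫ ω, (tokens π (E.obs ω) (rounds π (E.obs ω) B) : ℝ) ∂P =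
      ∫ ω, ∑ s ∈ Finset.range (rounds π (E.obs ω) B), E.meanTokens (arm π (E.obs ω) s) ∂P := by
  have h1 : ∀ ω, (tokens π (E.obs ω) (rounds π (E.obs ω) B) : ℝ) =
      ∑ s ∈ Finset.range B, ∑ i,
        (E.useSet π B s i).indicator (fun ω => ((E.obs ω s i).2 : ℝ) + 1) ω := fun ω => by
    rw [← E.sum_rounds_eq π B fun s i ω => ((E.obs ω s i).2 : ℝ) + 1]
    unfold tokens
    push_cast
    rfl
  have h2 := fun ω => E.sum_rounds_eq π B (fun _ i _ => E.meanTokens i) ω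
  simp only [h1, h2]
  rw [integral_finsetSum _ fun s _ => integrable_finsetSum _ fun i _ =>
      (E.integrable_obs_snd s i).indicator (E.measurableSet_useSet hπ B s i),
    integral_finsetSum _ fun s _ => integrable_finsetSum _ fun i _ =>
      (integrable_const _).indicator (E.measurableSet_useSet hπ B s i)]
  refine Finset.sum_congr rfl fun s _ => ?_
  rw [integral_finsetSum _ fun i _ =>
      (E.integrable_obs_snd s i).indicator (E.measurableSet_useSet hπ B s i),
    integral_finsetSum _ fun i _ =>
      (integrable_const _).indicator (E.measurableSet_useSet hπ B s i)]
  exact Finset.sum_congr rfl fun i _ => E.integral_useSet hπ B s i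

lemma Env.integrable_sum_meanTokens (hπ : ∀ t, Measurable (π t)) (B : ℕ) :
    Integrable (fun ω => ∑ s ∈ Finset.range (rounds π (E.obs ω) B),
      E.meanTokens (arm π (E.obs ω) s)) P := by
  simp only [fun ω => E.sum_rounds_eq π B (fun _ i _ => E.meanTokens i) ω]
  exact integrable_finsetSum _ fun s _ => integrable_finsetSum _ fun i _ =>
    (integrable_const _).indicator (E.measurableSet_useSet hπ B s i)

lemma Env.integrable_rounds (hπ : ∀ t, Measurable (π t)) (B : ℕ) :
    Integrable (fun ω => (rounds π (E.obs ω) B : ℝ)) P := by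
  refine Integrable.of_mem_Icc 0 B ?_ (.of_forall fun ω => ⟨by positivity, ?_⟩)
  · exact (measurable_from_nat.comp
      ((measurable_rounds hπ B).comp E.measurable_obs_all)).aemeasurable
  · exact_mod_cast rounds_le π (E.obs ω) B

lemma Env.integrable_tokens_rounds (hπ : ∀ t, Measurable (π t)) (B : ℕ) :
    Integrable (fun ω => (tokens π (E.obs ω) (rounds π (E.obs ω) B) : ℝ)) P := by
  refine Integrable.of_mem_Icc 0 (B + N) ?_ (.of_forall fun ω => ⟨by positivity, ?_⟩)
  · exact (measurable_from_nat.comp (measurable_apply_countable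
      (f := fun ω n => tokens π (E.obs ω) n) ((measurable_rounds hπ B).comp E.measurable_obs_all)
      fun n => (measurable_tokens hπ n).comp E.measurable_obs_all)).aemeasurable
  · exact_mod_cast tokens_rounds_le π (E.obs_snd_le ω) B

/-- No policy generates more tokens per round, in expectation, than the best drafter. -/
lemma Env.le_expectedRounds {g : ℝ} (hg : 0 < g) (hmax : ∀ i, E.meanTokens i ≤ g)
    (hπ : ∀ t, Measurable (π t)) (B : ℕ) : B / g ≤ expectedRounds E π B := by
  have h1 : (B : ℝ) ≤ ∫ ω, (tokens π (E.obs ω) (rounds π (E.obs ω) B) : ℝ) ∂P := by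
    have := integral_mono (integrable_const (B : ℝ)) (E.integrable_tokens_rounds hπ B)
      fun ω => Nat.cast_le.2 (le_tokens_rounds π (E.obs ω) B)
    simpa using this
  have h2 := integral_mono (E.integrable_sum_meanTokens hπ B)
    ((E.integrable_rounds hπ B).const_mul g) fun ω => by
      have := Finset.sum_le_sum (s := Finset.range (rounds π (E.obs ω) B))
        fun s _ => hmax (arm π (E.obs ω) s)
      simpa [mul_comm] using this
  rw [E.integral_tokens_rounds hπ B] at h1
  rw [integral_const_mul] at h2
  rw [div_le_iff₀ hg, mul_comm]
  exact h1.trans h2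

lemma Env.le_optimalRounds {g : ℝ} (hg : 0 < g) (hmax : ∀ i, E.meanTokens i ≤ g) [NeZero K]
    (B : ℕ) : B / g ≤ optimalRounds E B := by
  have : Nonempty {π : Policy K N // ∀ t, Measurable (π t)} :=
    ⟨⟨fun _ _ => 0, fun _ => measurable_const⟩⟩
  exact le_ciInf fun π => E.le_expectedRounds hg hmax π.2 B

/-- A policy that uses a best drafter from round `m` on, outside a set `A`, needs at most
`m + B * P A` rounds more than necessary. -/
lemma Env.expectedRounds_le {g : ℝ} (hg : 1 ≤ g) (hnonneg : ∀ i, 0 ≤ E.meanTokens i)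
    (hπ : ∀ t, Measurable (π t)) (B m : ℕ) {A : Set Ω} (hA : MeasurableSet A)
    (hbest : ∀ ω ∉ A, ∀ t, m ≤ t → E.meanTokens (arm π (E.obs ω) t) = g) :
    expectedRounds E π B ≤ B / g + N + m + B * P.real A := by
  have h1 : ∫ ω, (tokens π (E.obs ω) (rounds π (E.obs ω) B) : ℝ) ∂P ≤ B + N := by
    have := integral_mono (E.integrable_tokens_rounds hπ B) (integrable_const ((B + N : ℕ) : ℝ))
      fun ω => Nat.cast_le.2 (tokens_rounds_le π (E.obs_snd_le ω) B)
    simpa using this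
  -- On `A` the subtracted `B` makes the left side nonpositive; off `A` every needed round from `m`
  -- on contributes exactly `g`.
  have hpt : ∀ ω, g * (rounds π (E.obs ω) B : ℝ) - g * (m + A.indicator (fun _ => (B : ℝ)) ω) ≤
      ∑ s ∈ Finset.range (rounds π (E.obs ω) B), E.meanTokens (arm π (E.obs ω) s) := fun ω => by
    have h0 := Finset.sum_nonneg (s := Finset.range (rounds π (E.obs ω) B))
      fun s _ => hnonneg (arm π (E.obs ω) s)
    by_cases hω : ω ∈ A
    · have : (rounds π (E.obs ω) B : ℝ) ≤ B := by exact_mod_cast rounds_le π (E.obs ω) B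
      rw [Set.indicator_of_mem hω, ← mul_sub]
      refine le_trans (mul_nonpos_of_nonneg_of_nonpos (by linarith) ?_) h0
      have : (0 : ℝ) ≤ m := by positivity
      linarith
    · rw [Set.indicator_of_notMem hω, ← mul_sub, add_zero]
      rcases le_total (rounds π (E.obs ω) B) m with hm | hm
      · refine le_trans (mul_nonpos_of_nonneg_of_nonpos (by linarith) ?_) h0
        rw [sub_nonpos]; exact_mod_cast hm
      · calc g * ((rounds π (E.obs ω) B : ℝ) - m)
            = ∑ s ∈ Finset.Ico m (rounds π (E.obs ω) B), E.meanTokens (arm π (E.obs ω) s) := by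
              rw [Finset.sum_congr rfl fun s hs => hbest ω hω s (Finset.mem_Ico.1 hs).1]
              simp [Nat.cast_sub hm, mul_comm]
          _ ≤ _ := Finset.sum_le_sum_of_subset_of_nonneg
              (fun s hs => Finset.mem_range.2 (Finset.mem_Ico.1 hs).2)
              fun s _ _ => hnonneg _
  have hi1 : Integrable (fun ω => g * (rounds π (E.obs ω) B : ℝ)) P :=
    (E.integrable_rounds hπ B).const_mul g
  have hi3 : Integrable (A.indicator fun _ => (B : ℝ)) P := (integrable_const _).indicator hA
  have hi2 : Integrable (fun ω => g * ((m : ℝ) + A.indicator (fun _ => (B : ℝ)) ω)) P :=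
    ((integrable_const _).add hi3).const_mul g
  have h2 := integral_mono (hi1.sub hi2) (E.integrable_sum_meanTokens hπ B) hpt
  rw [← E.integral_tokens_rounds hπ B] at h2
  have h3 : ∫ ω, (g * (rounds π (E.obs ω) B : ℝ) -
      g * (m + A.indicator (fun _ => (B : ℝ)) ω)) ∂P =
      g * expectedRounds E π B - g * (m + P.real A * B) := by
    rw [integral_sub hi1 hi2, integral_const_mul, integral_const_mul,
      integral_add (integrable_const _) hi3, integral_indicator_const _ hA]
    simp [expectedRounds]
  have h4 : g * expectedRounds E π B - g * (m + P.real A * B) ≤ B + N := by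
    rw [← h3]; exact h2.trans h1
  have hg0 : 0 < g := by linarith
  have h5 : expectedRounds E π B ≤ (B + N) / g + (m + P.real A * B) := by
    rw [← sub_le_iff_le_add, le_div_iff₀ hg0]
    linarith
  have h6 : (N : ℝ) / g ≤ N := div_le_self (by positivity) hg
  rw [add_div] at h5
  linarith

end Wald

/-! ### Selecting the top half -/

section TopHalf

variable {K : ℕ} (R : Fin K → ℝ) (S : Finset (Fin K))

/-- The drafters of `S` that are ranked ahead of `i`. -/
noncomputable def ahead (i : Fin K) : Finset (Fin K) :=
  S.filter fun j => R i < R j ∨ (R j = R i ∧ j < i)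

/-- Being ahead is a strict order: whatever is ahead of `j` is ahead of `i`, and so is `j` itself.
-/
lemma ahead_card_lt {i j : Fin K} (hj : j ∈ S) (h : R i < R j ∨ (R j = R i ∧ j < i)) :
    (ahead R S j).card < (ahead R S i).card := by
  refine Finset.card_lt_card (Finset.ssubset_iff_subset_ne.2 ⟨fun l hl => ?_, fun he => ?_⟩)
  · obtain ⟨hl, h'⟩ := Finset.mem_filter.1 hl
    refine Finset.mem_filter.2 ⟨hl, ?_⟩
    rcases h with h | ⟨h, h2⟩ <;> rcases h' with h' | ⟨h', h2'⟩
    · exact .inl (h.trans h')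
    · exact .inl (h'.symm ▸ h)
    · exact .inl (h ▸ h')
    · exact .inr ⟨h'.trans h, h2'.trans h2⟩
  · have : j ∈ ahead R S j := he ▸ Finset.mem_filter.2 ⟨hj, h⟩
    rcases (Finset.mem_filter.1 this).2 with h | h
    · exact lt_irrefl _ h
    · exact lt_irrefl _ h.2

lemma ahead_card_injOn : Set.InjOn (fun i => (ahead R S i).card) S := by
  intro i hi j hj h
  by_contra hne
  rcases lt_trichotomy (R i) (R j) with hR | hR | hR
  · exact (ahead_card_lt R S hj (.inl hR)).ne' h
  · rcases lt_or_gt_of_ne hne with hlt | hlt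
    · exact (ahead_card_lt R S hi (.inr ⟨hR, hlt⟩)).ne h
    · exact (ahead_card_lt R S hj (.inr ⟨hR.symm, hlt⟩)).ne' h
  · exact (ahead_card_lt R S hi (.inl hR)).ne h

/-- The ranks are distinct and below `S.card`, so by counting every rank occurs. -/
lemma image_ahead_card : S.image (fun i => (ahead R S i).card) = Finset.range S.card := by
  refine Finset.eq_of_subset_of_card_le (fun n hn => ?_) ?_
  · obtain ⟨i, hi, rfl⟩ := Finset.mem_image.1 hn
    refine Finset.mem_range.2 (Finset.card_lt_card (Finset.ssubset_iff_subset_ne.2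
      ⟨Finset.filter_subset _ _, fun he => ?_⟩))
    have : i ∈ ahead R S i := he.symm ▸ hi
    rcases (Finset.mem_filter.1 this).2 with h | h
    · exact lt_irrefl _ h
    · exact lt_irrefl _ h.2
  · rw [Finset.card_range, Finset.card_image_of_injOn (ahead_card_injOn R S)]

/-- The number of survivors does not depend on the rewards, so neither does the schedule of
Sequential Halving. -/
lemma card_topHalf : (topHalf R S).card = (S.card + 1) / 2 := by
  change (S.filter fun i => (ahead R S i).card < (S.card + 1) / 2).card = _
  rw [← Finset.card_image_of_injOn
    ((ahead_card_injOn R S).mono (Finset.coe_subset.2 (Finset.filter_subset _ _)))]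
  have : (S.filter fun i => (ahead R S i).card < (S.card + 1) / 2).image
      (fun i => (ahead R S i).card) = Finset.range ((S.card + 1) / 2) := by
    ext n
    constructor
    · intro hn
      obtain ⟨i, hi, rfl⟩ := Finset.mem_image.1 hn
      exact Finset.mem_range.2 (Finset.mem_filter.1 hi).2
    · intro hn
      have hn' := Finset.mem_range.1 hn
      have : n ∈ S.image (fun i => (ahead R S i).card) := by
        rw [image_ahead_card]
        exact Finset.mem_range.2 (by omega)
      obtain ⟨i, hi, rfl⟩ := Finset.mem_image.1 this
      exact Finset.mem_image.2 ⟨i, Finset.mem_filter.2 ⟨hi, hn'⟩, rfl⟩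
  rw [this, Finset.card_range]

/-- If every drafter of `S` outside `G` has a smaller value than some drafter of `S`, then `G`
meets the top half. -/
lemma exists_mem_topHalf (hS : S.Nonempty) {G : Fin K → Prop}
    (h : ∀ i ∈ S, ¬ G i → ∃ j ∈ S, R i < R j) : ∃ i ∈ topHalf R S, G i := by
  have hc := hS.card_pos
  -- The drafter of rank `0` always survives, and nobody in `S` has a larger value.
  have : 0 ∈ S.image (fun i => (ahead R S i).card) := by
    rw [image_ahead_card]; exact Finset.mem_range.2 hc
  obtain ⟨i, hi, h0⟩ := Finset.mem_image.1 this
  refine ⟨i, Finset.mem_filter.2 ⟨hi, ?_⟩, ?_⟩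
  · change (ahead R S i).card < _
    omega
  · by_contra hG
    obtain ⟨j, hj, hlt⟩ := h i hi hG
    have := ahead_card_lt R S hj (.inl hlt)
    omega

variable [NeZero K]

lemma nthDrafter_eq {p : ℕ} (hp : p < S.card) :
    nthDrafter S p = (S.sort (· ≤ ·))[p]'(by simpa using hp) := by
  unfold nthDrafter
  exact (List.getElem_eq_getD (h := by simpa using hp) 0).symm

lemma nthDrafter_mem {p : ℕ} (hp : p < S.card) : nthDrafter S p ∈ S := by
  rw [nthDrafter_eq S hp]
  exact (Finset.mem_sort (r := (· ≤ ·))).1 (List.getElem_mem _)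

lemma nthDrafter_inj {p q : ℕ} (hp : p < S.card) (hq : q < S.card)
    (h : nthDrafter S p = nthDrafter S q) : p = q := by
  rw [nthDrafter_eq S hp, nthDrafter_eq S hq] at h
  exact (List.Nodup.getElem_inj_iff (Finset.sort_nodup S (· ≤ ·))).1 h

lemma exists_nthDrafter {i : Fin K} (hi : i ∈ S) : ∃ p < S.card, nthDrafter S p = i := by
  obtain ⟨p, hp, h⟩ := List.getElem_of_mem ((Finset.mem_sort (r := (· ≤ ·))).2 hi)
  have hp' : p < S.card := by simpa using hp
  exact ⟨p, hp', (nthDrafter_eq S hp').trans h⟩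

end TopHalf

/-! ### The schedule of Sequential Halving -/

/-- The number of drafters that survive `k` phases. -/
def shCard (K : ℕ) : ℕ → ℕ
  | 0 => K
  | k + 1 => (shCard K k + 1) / 2

/-- The number of rounds for each surviving drafter in phase `k`. -/
noncomputable def shPulls (K : ℕ) (T : ℝ) (k : ℕ) : ℕ :=
  ⌊T / ((shCard K k : ℝ) * (Nat.clog 2 K : ℝ))⌋₊

/-- The first round of phase `k`. -/
noncomputable def shTime (K : ℕ) (T : ℝ) : ℕ → ℕ
  | 0 => 0
  | k + 1 => shTime K T k + shCard K k * shPulls K T k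

section Schedule

variable {K : ℕ} {T : ℝ}

lemma shCard_pos (hK : 0 < K) (k : ℕ) : 0 < shCard K k := by
  induction k with
  | zero => exact hK
  | succ k ih => simp only [shCard]; omega

lemma shCard_le (k : ℕ) : shCard K k ≤ K := by
  induction k with
  | zero => exact le_rfl
  | succ k ih => simp only [shCard]; omega

/-- Halving with rounding up maps sizes at most `2 ^ (m + 1)` to sizes at most `2 ^ m`; `m` varies
in the induction. -/
lemma shCard_le_pow (k m : ℕ) (h : K ≤ 2 ^ (k + m)) : shCard K k ≤ 2 ^ m := by
  induction k generalizing m with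
  | zero => simpa [shCard] using h
  | succ k ih =>
    have := ih (m + 1) (by rwa [show k + (m + 1) = k + 1 + m by ring])
    rw [pow_succ] at this
    simp only [shCard]; omega

lemma shCard_clog (hK : 0 < K) : shCard K (Nat.clog 2 K) = 1 := by
  have h1 := shCard_le_pow (K := K) (Nat.clog 2 K) 0 (Nat.le_pow_clog one_lt_two K)
  have h2 := shCard_pos hK (Nat.clog 2 K)
  simp only [pow_zero] at h1
  omega

lemma shTime_mono : Monotone (shTime K T) :=
  monotone_nat_of_le_succ fun _ => Nat.le_add_right _ _

lemma shTime_le (hK : 0 < K) (hT : 0 ≤ T) (k : ℕ) (hk : k ≤ Nat.clog 2 K) :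
    (shTime K T k : ℝ) ≤ k * (T / Nat.clog 2 K) := by
  induction k with
  | zero => simp [shTime]
  | succ k ih =>
    have hc : (0 : ℝ) < shCard K k := by exact_mod_cast shCard_pos hK k
    have hl : (0 : ℝ) < Nat.clog 2 K := by exact_mod_cast (by omega : 0 < Nat.clog 2 K)
    have h1 : (shPulls K T k : ℝ) ≤ T / ((shCard K k : ℝ) * (Nat.clog 2 K : ℝ)) :=
      Nat.floor_le (by positivity)
    have h2 : (shCard K k : ℝ) * shPulls K T k ≤ T / Nat.clog 2 K := by
      calc (shCard K k : ℝ) * shPulls K T k ≤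
          shCard K k * (T / ((shCard K k : ℝ) * (Nat.clog 2 K : ℝ))) := by gcongr
        _ = T / Nat.clog 2 K := by field_simp
    have h3 := ih (by omega)
    simp only [shTime]
    push_cast
    linarith

lemma shTime_clog_le (hK : 0 < K) (hT : 0 ≤ T) : (shTime K T (Nat.clog 2 K) : ℝ) ≤ T := by
  refine (shTime_le hK hT _ le_rfl).trans ?_
  rcases Nat.eq_zero_or_pos (Nat.clog 2 K) with h | h
  · simp [h, hT]
  · have : (0 : ℝ) < Nat.clog 2 K := by exact_mod_cast h
    rw [mul_div_cancel₀ _ this.ne']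

/-- A bound uniform over the phases: at most `K` drafters share a phase, and rounding down loses
less than one. -/
lemma le_shPulls (hK : 0 < K) (hT : 0 ≤ T) (k : ℕ) (hk : k < Nat.clog 2 K) :
    T / (K * Nat.clog 2 K) - 1 ≤ shPulls K T k := by
  have hc : (0 : ℝ) < shCard K k := by exact_mod_cast shCard_pos hK k
  have hc' : (shCard K k : ℝ) ≤ K := by exact_mod_cast shCard_le k
  have hl : (0 : ℝ) < Nat.clog 2 K := by exact_mod_cast (by omega : 0 < Nat.clog 2 K)
  have h1 := Nat.sub_one_lt_floor (T / ((shCard K k : ℝ) * (Nat.clog 2 K : ℝ)))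
  have h2 : T / (K * Nat.clog 2 K) ≤ T / ((shCard K k : ℝ) * (Nat.clog 2 K : ℝ)) := by
    gcongr
  unfold shPulls
  linarith

variable {N t : ℕ} (r : Obs N → ℝ)

lemma shState_card_time (h : History K N t) (k : ℕ) :
    (shState r T h k).1.card = shCard K k ∧ (shState r T h k).2 = shTime K T k := by
  induction k with
  | zero => simp [shState, shCard, shTime]
  | succ k ih =>
    simp only [shState, shCard, shTime, card_topHalf, ih.1, ih.2, pulls, shPulls, and_self]

lemma shState_succ_fst (h : History K N t) (k : ℕ) : (shState r T h (k + 1)).1 =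
    topHalf (phaseReward r h (shTime K T k) (shTime K T (k + 1))) (shState r T h k).1 := by
  obtain ⟨h1, h2⟩ := shState_card_time (T := T) r h k
  simp only [shState, h1, h2, pulls]
  rfl

/-- The number of phases completed before round `t`. -/
noncomputable def phaseCount (K : ℕ) (T : ℝ) (t : ℕ) : ℕ :=
  ((Finset.range (Nat.clog 2 K)).filter fun m => shTime K T (m + 1) ≤ t).card

lemma phaseCount_of_le (ht : shTime K T (Nat.clog 2 K) ≤ t) :
    phaseCount K T t = Nat.clog 2 K := by
  unfold phaseCount
  rw [Finset.filter_true_of_mem, Finset.card_range]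
  intro m hm
  exact (shTime_mono (Finset.mem_range.1 hm)).trans ht

lemma phaseCount_of_mem {k : ℕ} (hk : k < Nat.clog 2 K) (h1 : shTime K T k ≤ t)
    (h2 : t < shTime K T (k + 1)) : phaseCount K T t = k := by
  unfold phaseCount
  have : ((Finset.range (Nat.clog 2 K)).filter fun m => shTime K T (m + 1) ≤ t) =
      Finset.range k := by
    ext m
    simp only [Finset.mem_filter, Finset.mem_range]
    constructor
    · rintro ⟨-, h⟩
      by_contra! hkm
      have := shTime_mono (K := K) (T := T) (Nat.succ_le_succ hkm)
      simp only [Nat.succ_eq_add_one] at this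
      omega
    · intro hm
      exact ⟨by omega, (shTime_mono hm).trans h1⟩
  rw [this, Finset.card_range]

lemma petc_eq [NeZero K] (h : History K N t) : petc r T t h =
    if phaseCount K T t < Nat.clog 2 K then
      nthDrafter (shState r T h (phaseCount K T t)).1
        ((t - shTime K T (phaseCount K T t)) / shPulls K T (phaseCount K T t))
    else nthDrafter (shState r T h (phaseCount K T t)).1 0 := by
  have hk : ((Finset.range (Nat.clog 2 K)).filter fun m =>
      (shState r T h (m + 1)).2 ≤ t).card = phaseCount K T t :=
    congrArg Finset.card (Finset.filter_congr fun m _ => by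
      rw [(shState_card_time (T := T) r h _).2])
  dsimp only [petc]
  rw [hk]
  simp only [(shState_card_time (T := T) r h _).2, pulls, shPulls,
    (shState_card_time (T := T) r h _).1]

/-! ### Sequential Halving along a run -/

lemma phaseReward_runHistory (π : Policy K N) (X : ℕ → Fin K → Obs N) {a b : ℕ} (hb : b ≤ t)
    (i : Fin K) : phaseReward r (runHistory π X t) a b i =
      ∑ s ∈ (Finset.Ico a b).filter (fun s => arm π X s = i), r (X s i) := by
  unfold phaseReward runHistory
  rw [Fin.sum_univ_eq_sum_range (fun s => if a ≤ s ∧ s < b ∧ arm π X s = i then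
    r (X s (arm π X s)) else 0) t, ← Finset.sum_filter]
  have : (Finset.range t).filter (fun s => a ≤ s ∧ s < b ∧ arm π X s = i) =
      (Finset.Ico a b).filter (fun s => arm π X s = i) := by
    ext s
    simp only [Finset.mem_filter, Finset.mem_range, Finset.mem_Ico]
    constructor
    · rintro ⟨-, h1, h2, h3⟩; exact ⟨⟨h1, h2⟩, h3⟩
    · rintro ⟨⟨h1, h2⟩, h3⟩; exact ⟨by omega, h1, h2, h3⟩
  rw [this]
  refine Finset.sum_congr rfl fun s hs => ?_
  rw [(Finset.mem_filter.1 hs).2]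

/-- The drafters that survive `k` phases in a run of a policy. -/
noncomputable def survivors (π : Policy K N) (T : ℝ) (X : ℕ → Fin K → Obs N) (k : ℕ) :
    Finset (Fin K) :=
  (shState r T (runHistory π X (shTime K T k)) k).1

/-- Later rounds do not affect completed phases, so the survivors may be computed from any history
that is long enough. -/
lemma shState_runHistory (π : Policy K N) (X : ℕ → Fin K → Obs N) (k : ℕ) :
    ∀ t, shTime K T k ≤ t → (shState r T (runHistory π X t) k).1 = survivors r π T X k := by
  induction k with
  | zero => intro t _; rfl
  | succ k ih =>
    intro t ht
    have h1 : shTime K T k ≤ shTime K T (k + 1) := shTime_mono (Nat.le_succ k)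
    unfold survivors
    rw [shState_succ_fst, shState_succ_fst, ih t (h1.trans ht), ih _ h1]
    congr 1
    funext i
    rw [phaseReward_runHistory r π X ht, phaseReward_runHistory r π X le_rfl]

lemma card_survivors (π : Policy K N) (X : ℕ → Fin K → Obs N) (k : ℕ) :
    (survivors r π T X k).card = shCard K k := (shState_card_time r _ k).1

lemma survivors_succ (π : Policy K N) (X : ℕ → Fin K → Obs N) (k : ℕ) :
    survivors r π T X (k + 1) =
      topHalf (phaseReward r (runHistory π X (shTime K T (k + 1))) (shTime K T k)
        (shTime K T (k + 1))) (survivors r π T X k) := by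
  rw [survivors, shState_succ_fst,
    shState_runHistory r π X k _ (shTime_mono (Nat.le_succ k))]

variable [NeZero K]

lemma arm_petc_of_le (X : ℕ → Fin K → Obs N) (ht : shTime K T (Nat.clog 2 K) ≤ t) :
    arm (petc r T) X t = nthDrafter (survivors r (petc r T) T X (Nat.clog 2 K)) 0 := by
  rw [arm_eq, petc_eq, phaseCount_of_le ht, if_neg (lt_irrefl _), shState_runHistory r _ X _ t ht]

lemma arm_petc_of_mem (X : ℕ → Fin K → Obs N) {k : ℕ} (hk : k < Nat.clog 2 K)
    (h1 : shTime K T k ≤ t) (h2 : t < shTime K T (k + 1)) : arm (petc r T) X t =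
      nthDrafter (survivors r (petc r T) T X k) ((t - shTime K T k) / shPulls K T k) := by
  rw [arm_eq, petc_eq, phaseCount_of_mem hk h1 h2, if_pos hk, shState_runHistory r _ X _ t h1]

/-- The total reward of drafter `i` in the `n` rounds from round `u` on. -/
def blockReward (X : ℕ → Fin K → Obs N) (u n : ℕ) (i : Fin K) : ℝ :=
  ∑ s ∈ Finset.Ico u (u + n), r (X s i)

/-- The key to handling adaptivity: the drafter at position `p` is used exactly in the `p`-th
consecutive block of the phase, whose rounds are fixed in advance. Only the identity of the drafter
is random. -/
lemma phaseReward_petc (X : ℕ → Fin K → Obs N) {k p : ℕ} (hk : k < Nat.clog 2 K)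
    (hp : p < shCard K k) (hn : 0 < shPulls K T k) :
    phaseReward r (runHistory (petc r T) X (shTime K T (k + 1))) (shTime K T k)
        (shTime K T (k + 1)) (nthDrafter (survivors r (petc r T) T X k) p) =
      blockReward r X (shTime K T k + p * shPulls K T k) (shPulls K T k)
        (nthDrafter (survivors r (petc r T) T X k) p) := by
  rw [phaseReward_runHistory r _ X le_rfl, blockReward]
  congr 1
  ext s
  have hc := card_survivors (T := T) r (petc r T) X k
  have hT : shTime K T (k + 1) = shTime K T k + shCard K k * shPulls K T k := rfl
  have hle : (p + 1) * shPulls K T k ≤ shCard K k * shPulls K T k := Nat.mul_le_mul_right _ hp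
  rw [add_mul, one_mul] at hle
  have hdiv : ∀ x : ℕ, x / shPulls K T k = p ↔
      p * shPulls K T k ≤ x ∧ x < p * shPulls K T k + shPulls K T k := fun x => by
    rw [Nat.div_eq_iff hn]
    omega
  simp only [Finset.mem_filter, Finset.mem_Ico]
  constructor
  · rintro ⟨⟨h1, h2⟩, h3⟩
    rw [arm_petc_of_mem r X hk h1 h2] at h3
    have hlt : (s - shTime K T k) / shPulls K T k < shCard K k :=
      Nat.div_lt_of_lt_mul (by rw [mul_comm]; omega)
    have := (hdiv _).1 (nthDrafter_inj _ (by rwa [hc]) (by rwa [hc]) h3)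
    omega
  · rintro ⟨h1, h2⟩
    have h3 : shTime K T k ≤ s := by omega
    have h4 : s < shTime K T (k + 1) := by omega
    refine ⟨⟨h3, h4⟩, ?_⟩
    rw [arm_petc_of_mem r X hk h3 h4, (hdiv _).2 (by omega)]

/-- The rewards in every block of rounds used by Sequential Halving are close to their means. -/
def Concentrated (T : ℝ) (μ : Fin K → ℝ) (δ : ℝ) (X : ℕ → Fin K → Obs N) : Prop :=
  ∀ k < Nat.clog 2 K, ∀ p < K, ∀ i,
    |blockReward r X (shTime K T k + p * shPulls K T k) (shPulls K T k) i -
      shPulls K T k * μ i| < shPulls K T k * δ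

variable {r} {μ : Fin K → ℝ} {δ : ℝ} {X : ℕ → Fin K → Obs N}

/-- If a best drafter takes part in a phase, its total exceeds that of every suboptimal participant,
as each total errs by less than half the gap. So the drafter ranked first is a best one, though
perhaps a different one in case of ties. -/
lemma exists_best_mem_survivors (hX : Concentrated r T μ δ X)
    (hδ : ∀ i, (∀ j, μ j ≤ μ i) → ∀ j, (¬ ∀ l, μ l ≤ μ j) → μ j + 2 * δ ≤ μ i) (k : ℕ)
    (hk : k ≤ Nat.clog 2 K) :
    ∃ i ∈ survivors r (petc r T) T X k, ∀ j, μ j ≤ μ i := by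
  induction k with
  | zero =>
    obtain ⟨i, hi⟩ := Finite.exists_max μ
    exact ⟨i, by simp [survivors, shState], hi⟩
  | succ k ih =>
    obtain ⟨i, hi, hbest⟩ := ih (by omega)
    rw [survivors_succ]
    refine exists_mem_topHalf _ _ ⟨i, hi⟩ fun j hj hbad => ⟨i, hi, ?_⟩
    have hc := card_survivors (T := T) r (petc r T) X k
    obtain ⟨p, hp, rfl⟩ := exists_nthDrafter _ hi
    obtain ⟨q, hq, rfl⟩ := exists_nthDrafter _ hj
    rw [hc] at hp hq
    have hpi := hX k hk p (hp.trans_le (shCard_le k)) (nthDrafter (survivors r (petc r T) T X k) p)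
    have hqj := hX k hk q (hq.trans_le (shCard_le k)) (nthDrafter (survivors r (petc r T) T X k) q)
    -- The strict inequality in `Concentrated` fails for an empty block, so it forces at least one
    -- pull.
    have hn : 0 < shPulls K T k := by
      rcases Nat.eq_zero_or_pos (shPulls K T k) with h0 | h0
      · rw [h0] at hpi
        simp only [Nat.cast_zero, zero_mul] at hpi
        exact absurd hpi (not_lt.2 (abs_nonneg _))
      · exact h0
    rw [phaseReward_petc r X hk hp hn, phaseReward_petc r X hk hq hn]
    have hgap := mul_le_mul_of_nonneg_left (hδ _ hbest _ hbad)
      (Nat.cast_nonneg (α := ℝ) (shPulls K T k))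
    have h1 := (abs_lt.1 hpi).1
    have h2 := (abs_lt.1 hqj).2
    rw [mul_add] at hgap
    linarith

lemma arm_petc_best (hX : Concentrated r T μ δ X)
    (hδ : ∀ i, (∀ j, μ j ≤ μ i) → ∀ j, (¬ ∀ l, μ l ≤ μ j) → μ j + 2 * δ ≤ μ i)
    (ht : shTime K T (Nat.clog 2 K) ≤ t) (j : Fin K) : μ j ≤ μ (arm (petc r T) X t) := by
  obtain ⟨i, hi, hbest⟩ := exists_best_mem_survivors hX hδ _ le_rfl
  have hc := card_survivors (T := T) r (petc r T) X (Nat.clog 2 K)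
  rw [shCard_clog (Nat.pos_of_neZero K)] at hc
  rw [arm_petc_of_le r X ht]
  have h0 := nthDrafter_mem (survivors r (petc r T) T X (Nat.clog 2 K)) (p := 0) (by omega)
  rw [Finset.card_le_one.1 hc.le _ h0 _ hi]
  exact hbest j

end Schedule

/-! ### Measurability of Pure Exploration-Then-Commit -/

section Measurability

variable {K N t : ℕ} {α β : Type*} [MeasurableSpace α]

/-- Handles sets of survivors through their countably many values, without a σ-algebra on `Finset
(Fin K)`. -/
lemma measurableSet_of_fibers [Countable β] {f : α → β} (hf : ∀ b, MeasurableSet {x | f x = b})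
    {Q : α → β → Prop} (hQ : ∀ b, MeasurableSet {x | Q x b}) :
    MeasurableSet {x | Q x (f x)} := by
  have : {x | Q x (f x)} = ⋃ b, {x | f x = b} ∩ {x | Q x b} := by
    ext x; simp
  rw [this]
  exact MeasurableSet.iUnion fun b => (hf b).inter (hQ b)

lemma measurableSet_topHalf {R : α → Fin K → ℝ} (hR : ∀ i, Measurable fun x => R x i)
    (S S' : Finset (Fin K)) : MeasurableSet {x | topHalf (R x) S = S'} := by
  have hcard : ∀ i, Measurable fun x => (ahead (R x) S i).card := fun i => by
    simp only [ahead, Finset.card_filter]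
    refine Finset.measurable_fun_sum _ fun j _ => Measurable.ite ?_ measurable_const measurable_const
    exact (measurableSet_lt (hR i) (hR j)).union
      ((measurableSet_eq_fun (hR j) (hR i)).inter (MeasurableSet.const _))
  have : {x | topHalf (R x) S = S'} = ⋂ i, {x | (i ∈ S ∧ (ahead (R x) S i).card <
      (S.card + 1) / 2) ↔ i ∈ S'} := by
    ext x
    simp only [Set.mem_ofPred_eq, Set.mem_iInter, Finset.ext_iff, topHalf, Finset.mem_filter, ahead]
  rw [this]
  refine MeasurableSet.iInter fun i => ?_
  have h : MeasurableSet {x | i ∈ S ∧ (ahead (R x) S i).card < (S.card + 1) / 2} :=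
    (MeasurableSet.const _).inter (measurableSet_lt (hcard i) measurable_const)
  by_cases hi : i ∈ S'
  · simpa only [hi, iff_true] using h
  · simp only [hi, iff_false]
    exact h.compl

lemma measurable_phaseReward {r : Obs N → ℝ} (hr : Measurable r) (a b : ℕ) (i : Fin K) :
    Measurable fun h : History K N t => phaseReward r h a b i := by
  refine Finset.measurable_fun_sum _ fun s _ => Measurable.ite ?_ ?_ measurable_const
  · refine (MeasurableSet.const _).inter ((MeasurableSet.const _).inter ?_)
    exact (measurable_fst.comp (measurable_pi_apply s)) (measurableSet_singleton i)
  · exact hr.comp (measurable_snd.comp (measurable_pi_apply s))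

lemma measurableSet_shState {r : Obs N → ℝ} (hr : Measurable r) (T : ℝ) (k : ℕ)
    (S : Finset (Fin K)) : MeasurableSet {h : History K N t | (shState r T h k).1 = S} := by
  induction k generalizing S with
  | zero => exact MeasurableSet.const (Finset.univ = S)
  | succ k ih =>
    simp only [shState_succ_fst]
    exact measurableSet_of_fibers ih
      (Q := fun h S' => topHalf (phaseReward r h (shTime K T k) (shTime K T (k + 1))) S' = S)
      fun S' => measurableSet_topHalf (fun i => measurable_phaseReward hr _ _ i) S' S

lemma measurable_petc [NeZero K] {r : Obs N → ℝ} (hr : Measurable r) (T : ℝ) (t : ℕ) :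
    Measurable (petc (K := K) r T t) := by
  intro A _
  simp only [Set.preimage, petc_eq]
  exact measurableSet_of_fibers (measurableSet_shState hr T (phaseCount K T t))
    (Q := fun _ S => (if phaseCount K T t < Nat.clog 2 K then
      nthDrafter S ((t - shTime K T (phaseCount K T t)) / shPulls K T (phaseCount K T t))
      else nthDrafter S 0) ∈ A) fun S => MeasurableSet.const _

end Measurability

/-! ### Concentration of the rewards -/

section Concentration

variable {K N : ℕ} {V : Type*} [Fintype V] {Ω : Type*} [MeasurableSpace Ω] {P : Measure Ω}
  (E : Env K N V P) {r : Obs N → ℝ}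

lemma Env.measurable_blockReward (hr : Measurable r) (u n : ℕ) (i : Fin K) :
    Measurable fun ω => blockReward r (E.obs ω) u n i :=
  Finset.measurable_fun_sum _ fun s _ => hr.comp (E.measurable_obs_apply s i)

/-- Where some block used by Sequential Halving has rewards far from their mean. -/
def Env.deviationSet (r : Obs N → ℝ) (T δ : ℝ) : Set Ω :=
  {ω | ¬ Concentrated r T (E.meanReward r) δ (E.obs ω)}

lemma Env.deviationSet_eq (r : Obs N → ℝ) (T δ : ℝ) : E.deviationSet r T δ =
    ⋃ x ∈ Finset.range (Nat.clog 2 K) ×ˢ (Finset.range K ×ˢ (Finset.univ : Finset (Fin K))),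
      {ω | shPulls K T x.1 * δ ≤
        |blockReward r (E.obs ω) (shTime K T x.1 + x.2.1 * shPulls K T x.1) (shPulls K T x.1) x.2.2 -
          shPulls K T x.1 * E.meanReward r x.2.2|} := by
  ext ω
  simp only [Env.deviationSet, Concentrated, Set.mem_ofPred_eq, not_forall, not_lt, Set.mem_iUnion,
    Finset.mem_product, Finset.mem_range, Finset.mem_univ, and_true, Prod.exists, exists_prop]
  constructor
  · rintro ⟨k, hk, p, hp, i, h⟩; exact ⟨k, p, i, ⟨hk, hp⟩, h⟩
  · rintro ⟨k, p, i, ⟨hk, hp⟩, h⟩; exact ⟨k, hk, p, hp, i, h⟩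

lemma Env.measurableSet_deviationSet (hr : Measurable r) (T δ : ℝ) :
    MeasurableSet (E.deviationSet r T δ) := by
  rw [E.deviationSet_eq]
  refine Finset.measurableSet_biUnion _ fun x _ => measurableSet_le measurable_const ?_
  exact ((E.measurable_blockReward hr _ _ _).sub_const _).abs

variable [IsProbabilityMeasure P]

/-- Hoeffding's inequality for the rewards of one drafter in a block of rounds. -/
lemma Env.measureReal_blockReward_le (hr : E.IsRewardDesign r) (u n : ℕ) (i : Fin K) {δ : ℝ}
    (hδ : 0 ≤ δ) :
    P.real {ω | n * δ ≤ |blockReward r (E.obs ω) u n i - n * E.meanReward r i|} ≤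
      2 * Real.exp (-(2 * n * δ ^ 2)) := by
  have hind : iIndepFun (fun s ω => r (E.obs ω s i) - E.meanReward r i) P :=
    E.indep_obs.comp (fun _ x => r (x i) - E.meanReward r i)
      fun _ => (hr.1.comp (measurable_pi_apply i)).sub_const _
  have hind' : iIndepFun (fun s ω => -(r (E.obs ω s i) - E.meanReward r i)) P :=
    hind.comp (fun _ x => -x) fun _ => measurable_neg
  have hsub : ∀ s, HasSubgaussianMGF (fun ω => r (E.obs ω s i) - E.meanReward r i)
      ((‖(1 : ℝ) - 0‖₊ / 2) ^ 2) P := fun s => by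
    have h := hasSubgaussianMGF_of_mem_Icc (μ := P) (X := fun ω => r (E.obs ω s i)) (a := 0) (b := 1)
      (hr.1.comp (E.measurable_obs_apply s i)).aemeasurable
      (.of_forall fun ω => hr.2.1 _ _ (E.rate_mem_Icc ω s i) (E.obs_snd_le ω s i))
    rwa [E.integral_obs s i hr.1] at h
  have hε : 0 ≤ n * δ := by positivity
  have h1 := HasSubgaussianMGF.measure_sum_ge_le_of_iIndepFun hind
    (s := Finset.Ico u (u + n)) (fun s _ => hsub s) hε
  have h2 := HasSubgaussianMGF.measure_sum_ge_le_of_iIndepFun hind'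
    (s := Finset.Ico u (u + n)) (fun s _ => (hsub s).neg) hε
  -- Each reward in `[0, 1]` has variance proxy `1 / 4`. For `n = 0` both exponents are `0`.
  have hexp : -(n * δ) ^ 2 / (2 * ((∑ _s ∈ Finset.Ico u (u + n),
      (‖(1 : ℝ) - 0‖₊ / 2) ^ 2 : NNReal) : ℝ)) = -(2 * n * δ ^ 2) := by
    rcases Nat.eq_zero_or_pos n with rfl | hn
    · simp
    · have : (n : ℝ) ≠ 0 := by positivity
      simp
      field_simp
  rw [hexp] at h1 h2
  have hsum : ∀ ω, blockReward r (E.obs ω) u n i - n * E.meanReward r i =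
      ∑ s ∈ Finset.Ico u (u + n), (r (E.obs ω s i) - E.meanReward r i) := fun ω => by
    simp [blockReward, Finset.sum_sub_distrib]
  have hset : {ω | n * δ ≤ |blockReward r (E.obs ω) u n i - n * E.meanReward r i|} =
      {ω | n * δ ≤ ∑ s ∈ Finset.Ico u (u + n), (r (E.obs ω s i) - E.meanReward r i)} ∪
      {ω | n * δ ≤ ∑ s ∈ Finset.Ico u (u + n), -(r (E.obs ω s i) - E.meanReward r i)} := by
    ext ω
    simp only [Set.mem_ofPred_eq, Set.mem_union, hsum, Finset.sum_neg_distrib, le_abs]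
  rw [hset, two_mul (Real.exp _)]
  exact (measureReal_union_le _ _).trans (add_le_add h1 h2)

/-- Union bound over phases, block positions and drafters; including every drafter covers whichever
one occupies the block. -/
lemma Env.measureReal_deviationSet_le [NeZero K] (hr : E.IsRewardDesign r) {T δ : ℝ} (hT : 0 ≤ T)
    (hδ : 0 ≤ δ) : P.real (E.deviationSet r T δ) ≤ Nat.clog 2 K * (K * K) *
      (2 * Real.exp (-(2 * (T / (K * Nat.clog 2 K) - 1) * δ ^ 2))) := by
  rw [E.deviationSet_eq]
  refine (measureReal_biUnion_finset_le _ _).trans ?_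
  refine (Finset.sum_le_sum (g := fun _ =>
    2 * Real.exp (-(2 * (T / (K * Nat.clog 2 K) - 1) * δ ^ 2))) fun x hx => ?_).trans_eq ?_
  · refine (E.measureReal_blockReward_le hr _ _ _ hδ).trans ?_
    have hk := Finset.mem_range.1 (Finset.mem_product.1 hx).1
    have := le_shPulls (K := K) (Nat.pos_of_neZero K) hT x.1 hk
    gcongr
  · simp

/-- With a budget of order `log B`, the probability of a deviation is of order `1 / B`. -/
lemma Env.mul_measureReal_deviationSet_le [NeZero K] (hr : E.IsRewardDesign r) {δ : ℝ} (hδ : 0 < δ)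
    {B : ℕ} (hB : 1 ≤ B) :
    B * P.real (E.deviationSet r (K * (Nat.clog 2 K + 1) / (2 * δ ^ 2) * Real.log B) δ) ≤
      Nat.clog 2 K * (K * K) * (2 * Real.exp (2 * δ ^ 2)) := by
  have hB' : (1 : ℝ) ≤ B := by exact_mod_cast hB
  have hlog : 0 ≤ Real.log B := Real.log_nonneg hB'
  have h := E.measureReal_deviationSet_le hr
    (T := K * (Nat.clog 2 K + 1) / (2 * δ ^ 2) * Real.log B) (by positivity) hδ.le
  -- For `K = 1` there are no phases, hence no deviations.
  rcases Nat.eq_zero_or_pos (Nat.clog 2 K) with h0 | h0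
  · rw [h0] at h ⊢
    simp only [Nat.cast_zero, zero_mul] at h ⊢
    rw [le_antisymm h measureReal_nonneg, mul_zero]
  · have hK : (0 : ℝ) < K := by exact_mod_cast Nat.pos_of_neZero K
    have hc : (0 : ℝ) < Nat.clog 2 K := by exact_mod_cast h0
    have he : Real.exp (-(2 * (K * (Nat.clog 2 K + 1) / (2 * δ ^ 2) * Real.log B /
        (K * Nat.clog 2 K) - 1) * δ ^ 2)) ≤ Real.exp (2 * δ ^ 2) * (B : ℝ)⁻¹ := by
      rw [← Real.exp_log (show 0 < (B : ℝ)⁻¹ by positivity), ← Real.exp_add, Real.log_inv]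
      refine Real.exp_le_exp.2 ?_
      -- The budget constant makes the exponent at least `log B`, up to the `2 * δ ^ 2` lost by
      -- rounding. Its `+ 1` only keeps the constant positive when `K = 1`, and the surplus is
      -- dropped.
      have : K * (Nat.clog 2 K + 1) / (2 * δ ^ 2) * Real.log B / (K * Nat.clog 2 K) * (2 * δ ^ 2) =
          Real.log B + Real.log B / Nat.clog 2 K := by
        field_simp
      have h3 : 0 ≤ Real.log B / Nat.clog 2 K := by positivity
      linarith
    calc (B : ℝ) * _ ≤ B * (Nat.clog 2 K * (K * K) * (2 * (Real.exp (2 * δ ^ 2) * (B : ℝ)⁻¹))) := by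
          refine mul_le_mul_of_nonneg_left (h.trans ?_) (by positivity)
          gcongr
      _ = _ := by field_simp

end Concentration

/-! ### The regret bound -/

/-- Take half the distance from the best suboptimal mean to a larger one; if all means are equal,
any positive value works. -/
lemma exists_gap {K : ℕ} (μ : Fin K → ℝ) : ∃ δ : ℝ, 0 < δ ∧
    ∀ i, (∀ j, μ j ≤ μ i) → ∀ j, (¬ ∀ l, μ l ≤ μ j) → μ j + 2 * δ ≤ μ i := by
  classical
  by_cases h : (Finset.univ.filter fun j => ¬ ∀ l, μ l ≤ μ j).Nonempty
  · obtain ⟨j, hj, hmax⟩ := Finset.exists_max_image _ μ h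
    obtain ⟨l, hl⟩ := not_forall.1 (Finset.mem_filter.1 hj).2
    rw [not_le] at hl
    refine ⟨(μ l - μ j) / 2, by linarith, fun i hi j' hj' => ?_⟩
    have := hmax j' (Finset.mem_filter.2 ⟨Finset.mem_univ _, hj'⟩)
    linarith [hi l]
  · refine ⟨1, one_pos, fun i _ j hj => absurd ⟨j, ?_⟩ h⟩
    exact Finset.mem_filter.2 ⟨Finset.mem_univ _, hj⟩

section Regret

variable {K N : ℕ} [NeZero K] {V : Type*} [Fintype V] {Ω : Type*} [MeasurableSpace Ω]
  {P : Measure Ω} [IsProbabilityMeasure P] (E : Env K N V P) {r : Obs N → ℝ}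

lemma Env.integral_switchCost_petc_le (r : Obs N → ℝ) {T lam : ℝ} (hT : 0 ≤ T) (hlam : 0 ≤ lam)
    (L B : ℕ) :
    ∫ ω, ∑ t ∈ Finset.Ico 1 (rounds (petc r T) (E.obs ω) B),
      switchCost (petc r T) (E.obs ω) lam L t ∂P ≤ lam * (K * (L + (T + 1) * (N + 1))) := by
  have h := integral_mono_of_nonneg (μ := P)
    (f := fun ω => ∑ t ∈ Finset.Ico 1 (rounds (petc r T) (E.obs ω) B),
      switchCost (petc r T) (E.obs ω) lam L t)
    (g := fun _ => lam * (K * (L + (T + 1) * (N + 1))))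
    (.of_forall fun ω => Finset.sum_nonneg fun t _ => switchCost_nonneg _ _ hlam L t)
    (integrable_const _) (.of_forall fun ω => ?_)
  · simpa using h
  · refine (sum_switchCost_le_of_const _ (E.obs_snd_le ω) hlam L (shTime K T (Nat.clog 2 K)) _
      fun t ht => ?_).trans ?_
    · rw [arm_petc_of_le r _ ht, arm_petc_of_le r _ le_rfl]
    · have := shTime_clog_le (Nat.pos_of_neZero K) hT
      beta_reduce
      gcongr

lemma Env.expectedRounds_petc_le (hN : 0 < N) (hr : E.IsRewardDesign r) {δ : ℝ}
    (hδ : ∀ i, (∀ j, E.meanReward r j ≤ E.meanReward r i) →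
      ∀ j, (¬ ∀ l, E.meanReward r l ≤ E.meanReward r j) →
        E.meanReward r j + 2 * δ ≤ E.meanReward r i) {T : ℝ} (hT : 0 ≤ T) (B : ℕ) :
    expectedRounds E (petc r T) B ≤
      optimalRounds E B + N + T + B * P.real (E.deviationSet r T δ) := by
  obtain ⟨i, hi⟩ := Finite.exists_max (E.meanReward r)
  have hα := hr.2.2 i hi
  have hg := E.one_le_meanTokens hN i
  have h1 := E.expectedRounds_le hg (fun j => zero_le_one.trans (E.one_le_meanTokens hN j))
    (measurable_petc hr.1 T) B (shTime K T (Nat.clog 2 K))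
    (E.measurableSet_deviationSet hr.1 T δ) fun ω hω t ht => by
      have hbest := hr.2.2 _ (arm_petc_best (not_not.1 hω) hδ ht)
      exact le_antisymm (E.meanTokens_mono hN (hα _)) (E.meanTokens_mono hN (hbest _))
  have h2 := E.le_optimalRounds (zero_lt_one.trans_le hg) (fun j => E.meanTokens_mono hN (hα j)) B
  have h3 := shTime_clog_le (Nat.pos_of_neZero K) hT
  linarith

end Regret

end MetaSD

theorem mainTheorem7 {K N : ℕ} [NeZero K] (hN : 0 < N) {V : Type*} [Fintype V]
    {Ω : Type*} [MeasurableSpace Ω] (P : Measure Ω) [IsProbabilityMeasure P]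
    (E : MetaSD.Env K N V P) (r : MetaSD.Obs N → ℝ)
    (hr : r = MetaSD.bdReward N ∨ r = MetaSD.beReward N ∨
      (Measurable r ∧
        (∀ (a : Fin N → ℝ) (n : ℕ), (∀ j, a j ∈ Set.Icc (0 : ℝ) 1) → n ≤ N →
          r (a, n) ∈ Set.Icc (0 : ℝ) 1) ∧
        ∀ i, (∀ j, E.meanReward r j ≤ E.meanReward r i) → ∀ j, E.alpha j ≤ E.alpha i)) :
    ∃ c : ℝ, 0 < c ∧ ∀ lam : ℝ, 0 ≤ lam → ∀ L : ℕ, ∃ C : ℝ, ∀ B : ℕ, 2 ≤ B →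
      MetaSD.regSwitch E (MetaSD.petc r (c * Real.log B)) B lam L ≤ C * Real.log B := by
  have hr' : E.IsRewardDesign r := by
    rcases hr with rfl | rfl | hr
    · exact E.isRewardDesign_bdReward hN
    · exact E.isRewardDesign_beReward hN
    · exact hr
  obtain ⟨δ, hδ, hgap⟩ := MetaSD.exists_gap (E.meanReward r)
  have hK : (0 : ℝ) < K := by exact_mod_cast Nat.pos_of_neZero K
  have hc : 0 < K * ((Nat.clog 2 K : ℝ) + 1) / (2 * δ ^ 2) := by positivity
  have hM := fun (B : ℕ) (hB : 1 ≤ B) => E.mul_measureReal_deviationSet_le hr' hδ hB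
  set c : ℝ := K * ((Nat.clog 2 K : ℝ) + 1) / (2 * δ ^ 2)
  set M : ℝ := Nat.clog 2 K * (K * K) * (2 * Real.exp (2 * δ ^ 2))
  have hM0 : 0 ≤ M := by positivity
  refine ⟨c, hc, fun lam hlam L => ?_⟩
  have hD : 0 ≤ N + M + lam * (K * (L + (N + 1))) := by positivity
  set D : ℝ := N + M + lam * (K * (L + (N + 1))) with hDdef
  -- `D` collects the terms independent of `B`, absorbed through `log B ≥ log 2`; the other two
  -- terms come from the length of the exploration and its switching costs.
  refine ⟨D / Real.log 2 + c + lam * (K * (c * (N + 1))), fun B hB => ?_⟩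
  have hlog2 : 0 < Real.log 2 := Real.log_pos one_lt_two
  have hlog : Real.log 2 ≤ Real.log B := Real.log_le_log two_pos (by exact_mod_cast hB)
  have hT : 0 ≤ c * Real.log B := by positivity
  have h1 := E.expectedRounds_petc_le hN hr' hgap hT B
  have h2 := E.integral_switchCost_petc_le r hT hlam L B
  have h3 := hM B (by omega)
  have h4 : D ≤ D / Real.log 2 * Real.log B := by
    rw [div_mul_eq_mul_div, le_div_iff₀ hlog2]
    exact mul_le_mul_of_nonneg_left hlog hD
  unfold MetaSD.regSwitch
  calc _ ≤ D + (c + lam * (K * (c * (N + 1)))) * Real.log B := by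
        rw [hDdef]; linarith
    _ ≤ _ := by linarith
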